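/- Let $\mathfrak a$ be an additive category. For complexes $X,Y$ in $\mathfrak a$ let $\mathrm{Hom}_{\mathfrak a}(X,Y)$ be the Hom-complex, $\mathrm{Hom}_{\mathfrak a}(X,Y)^n=\prod_{p\in\mathbb Z}\mathrm{Hom}_{\mathfrak a}(X^p,Y^{p+n})$ with $(df)^p=d_Y^{p+n}\circ f^p-(-1)^n f^{p+1}\circ d_X^p$, and let $C_{\rm dg}(\mathfrak a)$ be the resulting dg category of complexes. A morphism $f=(f^p)_p$ in it is *bounded* if $f^p=0$ whenever $|p|$ is sufficiently large; the bounded morphisms form a dg ideal, and the *Vogel dg category* $\mathcal V(\mathfrak a)$ is the factor dg category of $C_{\rm dg}(\mathfrak a)$ by this ideal. Let $\mathcal V^-(\mathfrak a)$ and $\mathcal V^+(\mathfrak a)$ be the full dg subcategories of $\mathcal V(\mathfrak a)$ formed by the bounded-above complexes ($X^n=0$ for $n\gg0$) and the bounded-below complexes ($X^n=0$ for $n\ll0$). The homotopy category $H^0(\mathcal C)$ of a dg category $\mathcal C$ has the same objects, and the zeroth cohomology groups of the morphism complexes as morphism groups. For $\mathcal C=\mathcal V(\mathfrak a),\mathcal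 V^-(\mathfrak a),\mathcal V^+(\mathfrak a)$ the shift $\Sigma$ on $H^0(\mathcal C)$ is given by the usual shift of complexes, and the exact triangles are those isomorphic to a standard triangle $X\xrightarrow{f}Y\to C\to\Sigma X$ with $C$ an internal cone in $\mathcal C$ of a closed morphism $f$ of degree zero, that is, an object with morphisms $j\colon Y\to C$, $t\colon C\to Y$, $p\colon C\to X$, $s\colon X\to C$ of degrees $0,0,1,-1$ such that $pj=0=ts$, $\mathrm{Id}_C=sp+jt$, $tj=\mathrm{Id}_Y$, $ps=\mathrm{Id}_X$, $d(j)=0=d(p)$ and $d(s)=jf$; the morphisms $Y\to C$ and $C\to\Sigma X$ are given by $j$ and $-p$. Then $H^0(\mathcal V(\mathfrak a))$, $H^0(\mathcal V^-(\mathfrak a))$ and $H^0(\mathcal V^+(\mathfrak a))$ are triangulated categories, and the following hold. 1. There is an orthogonal decomposition $H^0(\mathcal V(\mathfrak a))=H^0(\mathcal V^-(\mathfrak a))\times H^0(\mathcal V^+(\mathfrak a))$. That is, $H^0(\mathcal V^-(\mathfrak a))$ and $H^0(\mathcal V^+(\mathfrak a))$ are full triangulated subcategories of $H^0(\mathcal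 V(\mathfrak a))$; $\mathrm{Hom}_{H^0(\mathcal V(\mathfrak a))}(Y,X)=0$ and $\mathrm{Hom}_{H^0(\mathcal V(\mathfrak a))}(X,Y)=0$ for every bounded-above $X$ and every bounded-below $Y$; and every object $Z$ of $H^0(\mathcal V(\mathfrak a))$ fits into an exact triangle $Y\to Z\to X\to\Sigma Y$ with $Y$ bounded-below and $X$ bounded-above. 2. Let $\mathbf K^-(\mathfrak a)$, $\mathbf K^+(\mathfrak a)$ and $\mathbf K^b(\mathfrak a)$ be the homotopy categories of bounded-above, bounded-below and bounded complexes. The canonical functors $\mathbf K^{-}(\mathfrak a)\to H^0(\mathcal V^{-}(\mathfrak a))$ and $\mathbf K^{+}(\mathfrak a)\to H^0(\mathcal V^{+}(\mathfrak a))$, which are the identity on objects and send the homotopy class of a cochain map to its class, induce isomorphisms of triangulated categories from the Verdier quotients: $$\mathbf K^-(\mathfrak a)/\mathbf K^b(\mathfrak a)\xrightarrow{\ \sim\ }H^0(\mathcal V^-(\mathfrak a)),\qquad \mathbf K^+(\mathfrak a)/\mathbf K^b(\mathfrak a)\xrightarrow{\ \sim\ }H^0(\mathcal V^+(\mathfrak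 a)).$$ -/

import Mathlib

open CategoryTheory CategoryTheory.Limits CategoryTheory.Pretriangulated

universe w v u

noncomputable section

namespace VogelDG

/-! ### Dg categories -/

/-- A dg category (over `ℤ`) with class of objects `A`.  The morphism complexes are given by their
components `Hom X Y n`, and `d h` is the differential.  Composition is written in diagrammatic
order: `comp f g` is "first `f`, then `g`", so that the last axiom is the graded Leibniz rule
`d (g ∘ f) = d g ∘ f + (-1) ^ |g| g ∘ d f`. -/
class DGCategory (A : Type u) where
  Hom : A → A → ℤ → Type w
  [addCommGroup : ∀ X Y n, AddCommGroup (Hom X Y n)]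
  d : ∀ {X Y : A} {n m : ℤ}, n + 1 = m → (Hom X Y n →+ Hom X Y m)
  id : ∀ X : A, Hom X X 0
  comp : ∀ {X Y Z : A} {p q r : ℤ}, Hom X Y p → Hom Y Z q → p + q = r → Hom X Z r
  add_comp : ∀ {X Y Z : A} {p q r : ℤ} (f f' : Hom X Y p) (g : Hom Y Z q) (h : p + q = r),
    comp (f + f') g h = comp f g h + comp f' g h
  comp_add : ∀ {X Y Z : A} {p q r : ℤ} (f : Hom X Y p) (g g' : Hom Y Z q) (h : p + q = r),
    comp f (g + g') h = comp f g h + comp f g' h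
  id_comp : ∀ {X Y : A} {p : ℤ} (f : Hom X Y p), comp (id X) f (zero_add p) = f
  comp_id : ∀ {X Y : A} {p : ℤ} (f : Hom X Y p), comp f (id Y) (add_zero p) = f
  assoc : ∀ {W X Y Z : A} {p q r pq qr pqr : ℤ} (f : Hom W X p) (g : Hom X Y q) (k : Hom Y Z r)
    (h₁ : p + q = pq) (h₂ : q + r = qr) (h₃ : pq + r = pqr) (h₄ : p + qr = pqr),
    comp (comp f g h₁) k h₃ = comp f (comp g k h₂) h₄
  d_d : ∀ {X Y : A} {n m l : ℤ} (h : n + 1 = m) (h' : m + 1 = l) (f : Hom X Y n), d h' (d h f) = 0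
  d_comp : ∀ {X Y Z : A} {p q r p' q' r' : ℤ} (f : Hom X Y p) (g : Hom Y Z q) (h : p + q = r)
    (hp : p + 1 = p') (hq : q + 1 = q') (hr : r + 1 = r') (h₁ : p + q' = r') (h₂ : p' + q = r'),
    d hr (comp f g h) = comp f (d hq g) h₁ + q.negOnePow • comp (d hp f) g h₂

attribute [reducible, instance] DGCategory.addCommGroup

namespace DGCategory

variable {A : Type u} [DGCategory.{w} A]

/-- Composition as a biadditive map. -/
def compHom {X Y Z : A} {p q r : ℤ} (h : p + q = r) :
    Hom X Y p →+ Hom Y Z q →+ Hom X Z r :=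
  AddMonoidHom.mk' (fun f => AddMonoidHom.mk' (fun g => comp f g h)
    (fun g g' => comp_add f g g' h)) (fun f f' => by ext g; exact add_comp f f' g h)

@[simp]
theorem zero_comp {X Y Z : A} {p q r : ℤ} (g : Hom Y Z q) (h : p + q = r) :
    comp (0 : Hom X Y p) g h = 0 :=
  congrArg (fun k : Hom Y Z q →+ Hom X Z r => k g) (map_zero (compHom (X := X) h))

@[simp]
theorem comp_zero {X Y Z : A} {p q r : ℤ} (f : Hom X Y p) (h : p + q = r) :
    comp f (0 : Hom Y Z q) h = 0 :=
  map_zero (compHom (Z := Z) h f)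

theorem sub_comp {X Y Z : A} {p q r : ℤ} (f f' : Hom X Y p) (g : Hom Y Z q) (h : p + q = r) :
    comp (f - f') g h = comp f g h - comp f' g h :=
  congrArg (fun k : Hom Y Z q →+ Hom X Z r => k g) (map_sub (compHom (X := X) h) f f')

theorem comp_sub {X Y Z : A} {p q r : ℤ} (f : Hom X Y p) (g g' : Hom Y Z q) (h : p + q = r) :
    comp f (g - g') h = comp f g h - comp f g' h :=
  map_sub (compHom (Z := Z) h f) g g'

theorem d_id (X : A) {m : ℤ} (h : 0 + 1 = m) : d h (id X) = 0 := by
  have e := d_comp (id X) (id X) (zero_add 0) h h h (by simp) (by simp)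
  obtain rfl : (1 : ℤ) = m := by simpa using h
  rw [id_comp, id_comp, comp_id] at e
  simpa using e

/-- The composition of closed morphisms is closed. -/
theorem d_comp_eq_zero {X Y Z : A} {p q r p' q' r' : ℤ} (f : Hom X Y p) (g : Hom Y Z q)
    (h : p + q = r) (hp : p + 1 = p') (hq : q + 1 = q') (hr : r + 1 = r')
    (hf : d hp f = 0) (hg : d hq g = 0) : d hr (comp f g h) = 0 := by
  rw [d_comp f g h hp hq hr (by lia) (by lia), hf, hg]
  simp

end DGCategory

open DGCategory

/-! ### Full dg subcategories and factor dg categories -/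

/-- The full dg subcategory formed by the objects that satisfy `P`. -/
structure FullDG {A : Type u} (P : A → Prop) where
  obj : A
  property : P obj

instance {A : Type u} [DGCategory.{w} A] (P : A → Prop) : DGCategory.{w} (FullDG P) where
  Hom X Y n := Hom X.obj Y.obj n
  d h := d h
  id X := DGCategory.id X.obj
  comp f g h := comp f g h
  add_comp := add_comp
  comp_add := comp_add
  id_comp := id_comp
  comp_id := comp_id
  assoc := assoc
  d_d := d_d
  d_comp := d_comp

/-- A dg ideal: subcomplexes of the morphism complexes, closed under compositions with arbitrary
morphisms on both sides. -/
structure DGIdeal (A : Type u) [DGCategory.{w} A] where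
  carrier : ∀ (X Y : A) (n : ℤ), AddSubgroup (Hom X Y n)
  d_mem : ∀ {X Y : A} {n m : ℤ} (h : n + 1 = m) (f : Hom X Y n),
    f ∈ carrier X Y n → d h f ∈ carrier X Y m
  mem_comp : ∀ {X Y Z : A} {p q r : ℤ} (f : Hom X Y p) (g : Hom Y Z q) (h : p + q = r),
    f ∈ carrier X Y p → comp f g h ∈ carrier X Z r
  comp_mem : ∀ {X Y Z : A} {p q r : ℤ} (f : Hom X Y p) (g : Hom Y Z q) (h : p + q = r),
    g ∈ carrier Y Z q → comp f g h ∈ carrier X Z r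

/-- The objects of the factor dg category of `A` by the dg ideal `I`: the objects of `A`. -/
structure Factor {A : Type u} [DGCategory.{w} A] (I : DGIdeal A) where
  as : A

namespace Factor

variable {A : Type u} [DGCategory.{w} A] (I : DGIdeal A)

/-- The composition in the factor dg category, induced by the one in `A`. -/
def comp {X Y Z : A} {p q r : ℤ} (f : Hom X Y p ⧸ I.carrier X Y p)
    (g : Hom Y Z q ⧸ I.carrier Y Z q) (h : p + q = r) : Hom X Z r ⧸ I.carrier X Z r :=
  Quotient.map₂ (fun f g => DGCategory.comp f g h) (by
    intro f f' hf g g' hg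
    have hf' : f' - f ∈ I.carrier X Y p := by
      rw [sub_eq_neg_add]; exact QuotientAddGroup.leftRel_apply.1 hf
    have hg' : g' - g ∈ I.carrier Y Z q := by
      rw [sub_eq_neg_add]; exact QuotientAddGroup.leftRel_apply.1 hg
    refine QuotientAddGroup.leftRel_apply.2 ?_
    have e : -DGCategory.comp f g h + DGCategory.comp f' g' h =
        DGCategory.comp (f' - f) g h + DGCategory.comp f' (g' - g) h := by
      rw [sub_comp, comp_sub]; abel
    rw [e]
    exact add_mem (I.mem_comp _ _ h hf') (I.comp_mem _ _ h hg')) f g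

instance : DGCategory.{w} (Factor I) where
  Hom X Y n := Hom X.as Y.as n ⧸ I.carrier X.as Y.as n
  d h := QuotientAddGroup.map _ _ (d h) (fun f hf => I.d_mem h f hf)
  id X := QuotientAddGroup.mk (DGCategory.id X.as)
  comp f g h := Factor.comp I f g h
  add_comp := by
    rintro X Y Z p q r ⟨f⟩ ⟨f'⟩ ⟨g⟩ h
    exact congrArg QuotientAddGroup.mk (DGCategory.add_comp f f' g h)
  comp_add := by
    rintro X Y Z p q r ⟨f⟩ ⟨g⟩ ⟨g'⟩ h
    exact congrArg QuotientAddGroup.mk (DGCategory.comp_add f g g' h)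
  id_comp := by
    rintro X Y p ⟨f⟩
    exact congrArg QuotientAddGroup.mk (DGCategory.id_comp f)
  comp_id := by
    rintro X Y p ⟨f⟩
    exact congrArg QuotientAddGroup.mk (DGCategory.comp_id f)
  assoc := by
    rintro W X Y Z p q r pq qr pqr ⟨f⟩ ⟨g⟩ ⟨k⟩ h₁ h₂ h₃ h₄
    exact congrArg QuotientAddGroup.mk (DGCategory.assoc f g k h₁ h₂ h₃ h₄)
  d_d := by
    rintro X Y n m l h h' ⟨f⟩
    exact congrArg QuotientAddGroup.mk (DGCategory.d_d h h' f)
  d_comp := by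
    rintro X Y Z p q r p' q' r' ⟨f⟩ ⟨g⟩ h hp hq hr h₁ h₂
    exact congrArg QuotientAddGroup.mk (DGCategory.d_comp f g h hp hq hr h₁ h₂)

end Factor

/-! ### The homotopy category of a dg category -/

/-- The objects of the homotopy category `H⁰(A)` of a dg category: the objects of `A`. -/
structure H0 (A : Type u) where
  as : A

namespace H0

variable {A : Type u} [DGCategory.{w} A]

/-- The group of closed morphisms of degree zero. -/
def cocycles (X Y : A) : AddSubgroup (Hom X Y 0) :=
  (d (X := X) (Y := Y) (zero_add (1 : ℤ))).ker

/-- The coboundaries, as a subgroup of the closed morphisms of degree zero. -/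
def coboundaries (X Y : A) : AddSubgroup (cocycles X Y) :=
  (d (X := X) (Y := Y) (neg_add_cancel (1 : ℤ))).range.addSubgroupOf (cocycles X Y)

theorem mem_cocycles {X Y : A} (f : Hom X Y 0) : f ∈ cocycles X Y ↔ d (zero_add 1) f = 0 :=
  Iff.rfl

/-- The group of morphisms `H⁰(A(X, Y))` in the homotopy category. -/
def HomGroup (X Y : A) : Type w := cocycles X Y ⧸ coboundaries X Y

instance (X Y : A) : AddCommGroup (HomGroup X Y) :=
  inferInstanceAs (AddCommGroup (cocycles X Y ⧸ coboundaries X Y))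

/-- The class in `H⁰` of a closed morphism of degree zero. -/
def cls {X Y : A} (f : Hom X Y 0) (hf : d (zero_add 1) f = 0) : HomGroup X Y :=
  QuotientAddGroup.mk (⟨f, hf⟩ : cocycles X Y)

theorem cls_surjective {X Y : A} (F : HomGroup X Y) : ∃ f hf, cls f hf = F := by
  obtain ⟨⟨f, hf⟩, rfl⟩ := QuotientAddGroup.mk_surjective F
  exact ⟨f, hf, rfl⟩

theorem cls_eq_iff {X Y : A} (f g : Hom X Y 0) (hf : d (zero_add 1) f = 0)
    (hg : d (zero_add 1) g = 0) :
    cls f hf = cls g hg ↔ ∃ k : Hom X Y (-1), d (neg_add_cancel 1) k = g - f := by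
  refine QuotientAddGroup.eq.trans ?_
  rw [coboundaries, AddSubgroup.mem_addSubgroupOf, AddMonoidHom.mem_range]
  simp [sub_eq_neg_add]

/-- Composition in the homotopy category. -/
def comp {X Y Z : A} (F : HomGroup X Y) (G : HomGroup Y Z) : HomGroup X Z :=
  Quotient.map₂ (fun (f : cocycles X Y) (g : cocycles Y Z) =>
    (⟨DGCategory.comp f.1 g.1 (zero_add 0),
      d_comp_eq_zero _ _ _ (zero_add 1) (zero_add 1) _ f.2 g.2⟩ : cocycles X Z)) (by
    rintro ⟨f, hf⟩ ⟨f', hf'⟩ h ⟨g, hg⟩ ⟨g', hg'⟩ h'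
    obtain ⟨k, hk⟩ := (cls_eq_iff f f' hf hf').1 (Quotient.sound h)
    obtain ⟨l, hl⟩ := (cls_eq_iff g g' hg hg').1 (Quotient.sound h')
    refine Quotient.exact ((cls_eq_iff _ _ _ _).2
      ⟨DGCategory.comp k g (add_zero _) + DGCategory.comp f' l (zero_add _), ?_⟩)
    rw [mem_cocycles] at hf' hg
    rw [map_add, d_comp k g (add_zero _) (neg_add_cancel 1) (zero_add 1) _ (by lia) (by lia),
      d_comp f' l (zero_add _) (zero_add 1) (neg_add_cancel 1) _ (by lia) (by lia),
      hg, hf', hk, hl, sub_comp, comp_sub]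
    simp) F G

instance : Category (H0 A) where
  Hom X Y := HomGroup X.as Y.as
  id X := cls (DGCategory.id X.as) (d_id _ _)
  comp F G := comp F G
  id_comp := by
    rintro X Y ⟨f, hf⟩
    exact congrArg QuotientAddGroup.mk (Subtype.ext (DGCategory.id_comp f))
  comp_id := by
    rintro X Y ⟨f, hf⟩
    exact congrArg QuotientAddGroup.mk (Subtype.ext (DGCategory.comp_id f))
  assoc := by
    rintro W X Y Z ⟨f, hf⟩ ⟨g, hg⟩ ⟨k, hk⟩
    exact congrArg QuotientAddGroup.mk (Subtype.ext (DGCategory.assoc f g k _ _ _ _))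

/-- The morphism of the homotopy category given by a closed morphism of degree zero. -/
def homMk {X Y : A} (f : Hom X Y 0) (hf : d (zero_add 1) f = 0) : (⟨X⟩ : H0 A) ⟶ ⟨Y⟩ :=
  cls f hf

theorem homMk_surjective {X Y : A} (F : (⟨X⟩ : H0 A) ⟶ ⟨Y⟩) : ∃ f hf, homMk f hf = F :=
  cls_surjective F

theorem homMk_comp {X Y Z : A} (f : Hom X Y 0) (hf : d (zero_add 1) f = 0)
    (g : Hom Y Z 0) (hg : d (zero_add 1) g = 0) :
    homMk f hf ≫ homMk g hg = homMk (DGCategory.comp f g (zero_add 0))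
      (d_comp_eq_zero _ _ _ (zero_add 1) (zero_add 1) _ hf hg) := rfl

theorem homMk_congr {X Y : A} {f g : Hom X Y 0} (h : f = g) (hf : d (zero_add 1) f = 0)
    (hg : d (zero_add 1) g = 0) : homMk f hf = homMk g hg := by
  subst h; rfl

instance : Preadditive (H0 A) where
  homGroup X Y := inferInstanceAs (AddCommGroup (HomGroup X.as Y.as))
  add_comp := by
    rintro X Y Z ⟨f, hf⟩ ⟨f', hf'⟩ ⟨g, hg⟩
    exact congrArg QuotientAddGroup.mk (Subtype.ext (DGCategory.add_comp f f' g _))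
  comp_add := by
    rintro X Y Z ⟨f, hf⟩ ⟨g, hg⟩ ⟨g', hg'⟩
    exact congrArg QuotientAddGroup.mk (Subtype.ext (DGCategory.comp_add f g g' _))

/-- The inclusion `H⁰(A') ⥤ H⁰(A)` for the full dg subcategory `A'` of `A` formed by the objects
that satisfy `P`. -/
def incl (P : A → Prop) : H0 (FullDG P) ⥤ H0 A where
  obj X := ⟨X.as.obj⟩
  map F := F

end H0

/-! ### Internal shifts, internal cones, and exact triangles -/

/-- A choice of internal shifts of objects: for each `n` and `X`, an object `X[n]` and closed
mutually inverse morphisms `σ : X → X[n]` of degree `-n` and `τ : X[n] → X` of degree `n`. -/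
class DGShift (A : Type u) [DGCategory.{w} A] where
  shift : ℤ → A → A
  σ : ∀ (n : ℤ) (X : A), Hom X (shift n X) (-n)
  τ : ∀ (n : ℤ) (X : A), Hom (shift n X) X n
  d_σ : ∀ (n : ℤ) (X : A) {m : ℤ} (h : -n + 1 = m), d h (σ n X) = 0
  d_τ : ∀ (n : ℤ) (X : A) {m : ℤ} (h : n + 1 = m), d h (τ n X) = 0
  σ_τ : ∀ (n : ℤ) (X : A), comp (σ n X) (τ n X) (neg_add_cancel n) = DGCategory.id X
  τ_σ : ∀ (n : ℤ) (X : A), comp (τ n X) (σ n X) (add_neg_cancel n) = DGCategory.id (shift n X)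

open DGShift

instance {A : Type u} [DGCategory.{w} A] [DGShift A] (I : DGIdeal A) : DGShift (Factor I) where
  shift n X := ⟨shift n X.as⟩
  σ n X := QuotientAddGroup.mk (σ n X.as)
  τ n X := QuotientAddGroup.mk (τ n X.as)
  d_σ n X _ h := congrArg QuotientAddGroup.mk (d_σ n X.as h)
  d_τ n X _ h := congrArg QuotientAddGroup.mk (d_τ n X.as h)
  σ_τ n X := congrArg QuotientAddGroup.mk (σ_τ n X.as)
  τ_σ n X := congrArg QuotientAddGroup.mk (τ_σ n X.as)

/-- A full dg subcategory which is closed under the shifts inherits them. -/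
@[reducible]
def FullDG.dgShift {A : Type u} [DGCategory.{w} A] [DGShift A] (P : A → Prop)
    (hP : ∀ n X, P X → P (shift n X)) : DGShift (FullDG P) where
  shift n X := ⟨shift n X.obj, hP n _ X.property⟩
  σ n X := σ n X.obj
  τ n X := τ n X.obj
  d_σ n X _ h := d_σ n X.obj h
  d_τ n X _ h := d_τ n X.obj h
  σ_τ n X := σ_τ n X.obj
  τ_σ n X := τ_σ n X.obj

/-- The objects of the category `Gr A` of homogeneous morphisms of arbitrary degrees (it is only
used in order to verify identities between composites). -/
structure Gr (A : Type u) where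
  as : A

namespace Gr

variable {A : Type u} [DGCategory.{w} A]

theorem sigma_ext {X Y : A} {p q : ℤ} (h : p = q) {f : Hom X Y p} {g : Hom X Y q}
    (e : ∀ (r : ℤ) (h : p + 0 = r) (h' : q + 0 = r),
      comp f (DGCategory.id Y) h = comp g (DGCategory.id Y) h') :
    (⟨p, f⟩ : Σ n, Hom X Y n) = ⟨q, g⟩ := by
  subst h
  have := e p (add_zero p) (add_zero p)
  rw [comp_id, comp_id] at this
  rw [this]

instance : Category (Gr A) where
  Hom X Y := Σ n, Hom X.as Y.as n
  id X := ⟨0, DGCategory.id X.as⟩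
  comp f g := ⟨f.1 + g.1, comp f.2 g.2 rfl⟩
  id_comp := by
    rintro X Y ⟨p, f⟩
    refine sigma_ext (zero_add p) (fun r h h' => ?_)
    rw [assoc _ _ _ rfl h' _ (by lia), DGCategory.id_comp]
  comp_id := by
    rintro X Y ⟨p, f⟩
    refine sigma_ext (add_zero p) (fun r h h' => ?_)
    rw [assoc _ _ _ rfl (add_zero 0) _ (by lia), DGCategory.id_comp]
  assoc := by
    rintro W X Y Z ⟨p, f⟩ ⟨q, g⟩ ⟨n, k⟩
    refine sigma_ext (add_assoc p q n) (fun r h h' => ?_)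
    rw [assoc f g k rfl rfl rfl (by lia)]
    obtain rfl : p + q + n = r := by simpa using h
    rw [assoc f _ _ rfl (add_zero _) h' (by lia), DGCategory.comp_id, DGCategory.comp_id]

/-- A homogeneous morphism, as a morphism in `Gr A`. -/
def hom {X Y : A} {n : ℤ} (f : Hom X Y n) : (⟨X⟩ : Gr A) ⟶ ⟨Y⟩ := ⟨n, f⟩

theorem hom_injective {X Y : A} {n : ℤ} {f g : Hom X Y n} (h : hom f = hom g) : f = g := by
  exact eq_of_heq (Sigma.mk.inj h).2

theorem hom_comp {X Y Z : A} {p q r : ℤ} (f : Hom X Y p) (g : Hom Y Z q) (h : p + q = r) :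
    hom (comp f g h) = hom f ≫ hom g := by
  subst h; rfl

theorem hom_id (X : A) : hom (DGCategory.id X) = 𝟙 (⟨X⟩ : Gr A) := rfl

variable [DGShift A]

@[simp]
theorem hom_σ_τ (n : ℤ) (X : A) : hom (σ n X) ≫ hom (τ n X) = 𝟙 _ := by
  rw [← hom_comp _ _ (neg_add_cancel n), σ_τ, hom_id]

@[simp]
theorem hom_τ_σ (n : ℤ) (X : A) : hom (τ n X) ≫ hom (σ n X) = 𝟙 _ := by
  rw [← hom_comp _ _ (add_neg_cancel n), τ_σ, hom_id]

@[simp]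
theorem hom_σ_τ_assoc (n : ℤ) (X : A) {Z : Gr A} (f : (⟨X⟩ : Gr A) ⟶ Z) :
    hom (σ n X) ≫ hom (τ n X) ≫ f = f := by
  rw [← Category.assoc, hom_σ_τ, Category.id_comp]

@[simp]
theorem hom_τ_σ_assoc (n : ℤ) (X : A) {Z : Gr A} (f : (⟨shift n X⟩ : Gr A) ⟶ Z) :
    hom (τ n X) ≫ hom (σ n X) ≫ f = f := by
  rw [← Category.assoc, hom_τ_σ, Category.id_comp]

end Gr

namespace H0

variable {A : Type u} [DGCategory.{w} A] [DGShift A]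

/-- The shift of a closed morphism `f` of degree zero: the composition `X[n] → X → Y → Y[n]`. -/
def shiftHom (n : ℤ) {X Y : A} (f : Hom X Y 0) : Hom (shift n X) (shift n Y) 0 :=
  DGCategory.comp (DGCategory.comp (τ n X) f (add_zero n)) (σ n Y) (add_neg_cancel n)

theorem d_shiftHom (n : ℤ) {X Y : A} (f : Hom X Y 0) (hf : d (zero_add 1) f = 0) :
    d (zero_add 1) (shiftHom n f) = 0 :=
  d_comp_eq_zero _ _ _ rfl rfl _
    (d_comp_eq_zero _ _ _ rfl (zero_add 1) _ (d_τ n X _) hf) (d_σ n Y _)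

theorem shiftHom_sub (n : ℤ) {X Y : A} (f g : Hom X Y 0) :
    shiftHom n (f - g) = shiftHom n f - shiftHom n g := by
  rw [shiftHom, comp_sub, sub_comp]; rfl

theorem hom_shiftHom (n : ℤ) {X Y : A} (f : Hom X Y 0) :
    Gr.hom (shiftHom n f) = Gr.hom (τ n X) ≫ Gr.hom f ≫ Gr.hom (σ n Y) := by
  simp [shiftHom, Gr.hom_comp]

/-- The shift functors of the homotopy category. -/
def shiftFun (n : ℤ) : H0 A ⥤ H0 A where
  obj X := ⟨shift n X.as⟩
  map {X Y} F := Quotient.map (fun (f : cocycles X.as Y.as) =>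
    (⟨shiftHom n f.1, d_shiftHom n f.1 f.2⟩ : cocycles (shift n X.as) (shift n Y.as))) (by
      rintro ⟨f, hf⟩ ⟨g, hg⟩ h
      obtain ⟨k, hk⟩ := (cls_eq_iff f g hf hg).1 (Quotient.sound h)
      refine Quotient.exact ((cls_eq_iff _ _ _ _).2 ⟨n.negOnePow • DGCategory.comp
        (DGCategory.comp (τ n X.as) k rfl) (σ n Y.as) (by lia), ?_⟩)
      rw [Units.smul_def, map_zsmul, d_comp _ _ _ (show n + -1 + 1 = n by lia) rfl (neg_add_cancel 1) (by lia) (by lia), d_σ,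
        d_comp _ _ _ rfl (neg_add_cancel 1) _ (by lia) (by lia), d_τ, hk]
      rw [DGCategory.comp_zero, DGCategory.zero_comp, smul_zero, add_zero, zero_add, ← Units.smul_def, smul_smul,
        Int.negOnePow_neg, Int.units_mul_self, one_smul, comp_sub, sub_comp]
      rfl) F
  map_id X := congrArg QuotientAddGroup.mk (Subtype.ext (Gr.hom_injective (by
    rw [hom_shiftHom]; simp [Gr.hom_id])))
  map_comp := by
    rintro X Y Z ⟨f, hf⟩ ⟨g, hg⟩
    refine congrArg QuotientAddGroup.mk (Subtype.ext (Gr.hom_injective ?_))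
    simp [hom_shiftHom, Gr.hom_comp]

theorem shiftFun_map_homMk (n : ℤ) {X Y : A} (f : Hom X Y 0) (hf : d (zero_add 1) f = 0) :
    (shiftFun n).map (homMk f hf) = homMk (shiftHom n f) (d_shiftHom n f hf) := rfl

/-- An isomorphism in the homotopy category, given by mutually inverse closed morphisms. -/
def isoMk {X Y : A} (f : Hom X Y 0) (hf : d (zero_add 1) f = 0) (g : Hom Y X 0)
    (hg : d (zero_add 1) g = 0) (hfg : DGCategory.comp f g (zero_add 0) = DGCategory.id X)
    (hgf : DGCategory.comp g f (zero_add 0) = DGCategory.id Y) : (⟨X⟩ : H0 A) ≅ ⟨Y⟩ where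
  hom := homMk f hf
  inv := homMk g hg
  hom_inv_id := homMk_congr hfg _ _
  inv_hom_id := homMk_congr hgf _ _

theorem eqToHom_shift {m n : ℤ} (h : m = n) (X : A)
    (e : (⟨shift m X⟩ : H0 A) = ⟨shift n X⟩) :
    eqToHom e = homMk (DGCategory.comp (τ m X) (σ n X) (by lia))
      (d_comp_eq_zero _ _ _ rfl rfl _ (d_τ m X _) (d_σ n X _)) := by
  subst h
  exact homMk_congr (τ_σ m X).symm (d_id _ _) _

theorem shiftHom_τ (n : ℤ) {X Y : A} (f : Hom X Y 0) :
    DGCategory.comp (shiftHom n f) (τ n Y) (zero_add n) =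
      DGCategory.comp (τ n X) f (add_zero n) :=
  Gr.hom_injective (by simp [hom_shiftHom, Gr.hom_comp])

/-- The structure morphism `X → X[0]`, as a morphism of degree zero. -/
def toShiftZero (X : A) : Hom X (shift 0 X) 0 := σ 0 X

theorem d_toShiftZero (X : A) : d (zero_add 1) (toShiftZero X) = 0 := d_σ 0 X _

theorem hom_toShiftZero (X : A) : Gr.hom (toShiftZero X) = Gr.hom (σ 0 X) := rfl

/-- The identification of `X[0]` with `X`. -/
def shiftZero : shiftFun 0 ≅ 𝟭 (H0 A) :=
  NatIso.ofComponents (fun X => isoMk (τ 0 X.as) (d_τ 0 X.as _)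
    (toShiftZero X.as) (d_toShiftZero X.as)
    (τ_σ 0 X.as) (σ_τ 0 X.as)) (by
      rintro X Y ⟨f, hf⟩
      exact homMk_congr (shiftHom_τ 0 f) _ _)

/-- The canonical morphism `X[m + n] → X → X[m] → X[m][n]`. -/
def shiftAddHom (m n : ℤ) (X : A) : Hom (shift (m + n) X) (shift n (shift m X)) 0 :=
  DGCategory.comp (DGCategory.comp (τ (m + n) X) (σ m X) rfl) (σ n (shift m X)) (by lia)

/-- The canonical morphism `X[m][n] → X[m] → X → X[m + n]`. -/
def shiftAddInv (m n : ℤ) (X : A) : Hom (shift n (shift m X)) (shift (m + n) X) 0 :=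
  DGCategory.comp (DGCategory.comp (τ n (shift m X)) (τ m X) rfl) (σ (m + n) X) (by lia)

theorem d_shiftAddHom (m n : ℤ) (X : A) : d (zero_add 1) (shiftAddHom m n X) = 0 :=
  d_comp_eq_zero _ _ _ rfl rfl _
    (d_comp_eq_zero _ _ _ rfl rfl _ (d_τ _ _ _) (d_σ _ _ _)) (d_σ _ _ _)

theorem d_shiftAddInv (m n : ℤ) (X : A) : d (zero_add 1) (shiftAddInv m n X) = 0 :=
  d_comp_eq_zero _ _ _ rfl rfl _
    (d_comp_eq_zero _ _ _ rfl rfl _ (d_τ _ _ _) (d_τ _ _ _)) (d_σ _ _ _)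

theorem hom_shiftAddHom (m n : ℤ) (X : A) : Gr.hom (shiftAddHom m n X) =
    Gr.hom (τ (m + n) X) ≫ Gr.hom (σ m X) ≫ Gr.hom (σ n (shift m X)) := by
  simp [shiftAddHom, Gr.hom_comp]

theorem hom_shiftAddInv (m n : ℤ) (X : A) : Gr.hom (shiftAddInv m n X) =
    Gr.hom (τ n (shift m X)) ≫ Gr.hom (τ m X) ≫ Gr.hom (σ (m + n) X) := by
  simp [shiftAddInv, Gr.hom_comp]

theorem shiftAddHom_naturality (m n : ℤ) {X Y : A} (f : Hom X Y 0) :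
    DGCategory.comp (shiftHom (m + n) f) (shiftAddHom m n Y) (zero_add 0) =
      DGCategory.comp (shiftAddHom m n X) (shiftHom n (shiftHom m f)) (zero_add 0) :=
  Gr.hom_injective (by simp [hom_shiftHom, hom_shiftAddHom, Gr.hom_comp])

theorem shiftAddHom_inv (m n : ℤ) (X : A) :
    DGCategory.comp (shiftAddHom m n X) (shiftAddInv m n X) (zero_add 0) =
      DGCategory.id (shift (m + n) X) :=
  Gr.hom_injective (by simp [hom_shiftAddHom, hom_shiftAddInv, Gr.hom_comp, Gr.hom_id])

theorem shiftAddInv_hom (m n : ℤ) (X : A) :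
    DGCategory.comp (shiftAddInv m n X) (shiftAddHom m n X) (zero_add 0) =
      DGCategory.id (shift n (shift m X)) :=
  Gr.hom_injective (by simp [hom_shiftAddHom, hom_shiftAddInv, Gr.hom_comp, Gr.hom_id])

/-- The identification of `X[m + n]` with `X[m][n]`, through the structure morphisms to `X`. -/
def shiftAdd (m n : ℤ) : shiftFun (A := A) (m + n) ≅ shiftFun m ⋙ shiftFun n :=
  NatIso.ofComponents (fun X => isoMk (shiftAddHom m n X.as) (d_shiftAddHom m n X.as)
    (shiftAddInv m n X.as) (d_shiftAddInv m n X.as)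
    (shiftAddHom_inv m n X.as) (shiftAddInv_hom m n X.as)) (by
      rintro X Y ⟨f, hf⟩
      exact homMk_congr (shiftAddHom_naturality m n f) _ _)

theorem shiftAdd_assoc (m₁ m₂ m₃ : ℤ) (X : A) :
    DGCategory.comp (shiftAddHom (m₁ + m₂) m₃ X) (shiftHom m₃ (shiftAddHom m₁ m₂ X))
        (zero_add 0) =
      DGCategory.comp (DGCategory.comp (τ (m₁ + m₂ + m₃) X) (σ (m₁ + (m₂ + m₃)) X) (by lia))
        (DGCategory.comp (shiftAddHom m₁ (m₂ + m₃) X) (shiftAddHom m₂ m₃ (shift m₁ X))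
          (zero_add 0)) (zero_add 0) :=
  Gr.hom_injective (by simp [hom_shiftHom, hom_shiftAddHom, Gr.hom_comp])

theorem zero_shiftAdd (n : ℤ) (X : A) :
    shiftAddHom 0 n X = DGCategory.comp (DGCategory.comp (τ (0 + n) X) (σ n X) (by lia))
      (shiftHom n (toShiftZero X)) (zero_add 0) :=
  Gr.hom_injective (by simp [hom_shiftHom, hom_shiftAddHom, hom_toShiftZero, Gr.hom_comp])

theorem shiftAdd_zero (n : ℤ) (X : A) :
    shiftAddHom n 0 X = DGCategory.comp (DGCategory.comp (τ (n + 0) X) (σ n X) (by lia))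
      (toShiftZero (shift n X)) (zero_add 0) :=
  Gr.hom_injective (by simp [hom_toShiftZero, hom_shiftAddHom, Gr.hom_comp])

instance : HasShift (H0 A) ℤ :=
  hasShiftMk (H0 A) ℤ
    { F := shiftFun
      zero := shiftZero
      add := shiftAdd
      assoc_hom_app := fun m₁ m₂ m₃ X =>
        (homMk_congr (shiftAdd_assoc m₁ m₂ m₃ X.as) _ _).trans
          (congrArg (fun z => z ≫ homMk (shiftAddHom m₁ (m₂ + m₃) X.as) (d_shiftAddHom _ _ _) ≫
            homMk (shiftAddHom m₂ m₃ (shift m₁ X.as)) (d_shiftAddHom _ _ _))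
            (eqToHom_shift (add_assoc m₁ m₂ m₃) X.as _).symm)
      zero_add_hom_app := fun n X =>
        (homMk_congr (zero_shiftAdd n X.as) _ _).trans
          (congrArg (fun z => z ≫ homMk (shiftHom n (toShiftZero X.as))
            (d_shiftHom n _ (d_toShiftZero _))) (eqToHom_shift (zero_add n) X.as _).symm)
      add_zero_hom_app := fun n X =>
        (homMk_congr (shiftAdd_zero n X.as) _ _).trans
          (congrArg (fun z => z ≫ homMk (toShiftZero (shift n X.as)) (d_toShiftZero _))
            (eqToHom_shift (add_zero n) X.as _).symm) }

end H0

/-- An internal cone of a closed morphism `f : X → Y` of degree zero. -/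
structure InternalCone {A : Type u} [DGCategory.{w} A] {X Y : A} (f : Hom X Y 0) where
  obj : A
  j : Hom Y obj 0
  t : Hom obj Y 0
  p : Hom obj X 1
  s : Hom X obj (-1)
  j_p : comp j p (zero_add 1) = 0
  s_t : comp s t (add_zero (-1)) = 0
  id_obj : comp p s (add_neg_cancel 1) + comp t j (zero_add 0) = DGCategory.id obj
  j_t : comp j t (zero_add 0) = DGCategory.id Y
  s_p : comp s p (neg_add_cancel 1) = DGCategory.id X
  d_j : d (zero_add 1) j = 0
  d_p : d one_add_one_eq_two p = 0
  d_s : d (neg_add_cancel 1) s = comp f j (zero_add 0)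

namespace H0

variable {A : Type u} [DGCategory.{w} A] [DGShift A]

/-- The standard triangle `X → Y → C → X[1]` given by an internal cone `C` of `f : X → Y`.  The
last morphism is the negative of `C → X → X[1]`; this is the sign convention of Mathlib for the
homotopy category of complexes. -/
def coneTriangle {X Y : A} (f : Hom X Y 0) (hf : d (zero_add 1) f = 0) (c : InternalCone f) :
    Triangle (H0 A) :=
  Triangle.mk (X := ⟨X⟩) (Y := ⟨Y⟩) (Z := ⟨c.obj⟩) (homMk f hf) (homMk c.j c.d_j)
    (-homMk (Y := shift 1 X) (DGCategory.comp c.p (σ 1 X) (add_neg_cancel 1))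
      (d_comp_eq_zero _ _ _ one_add_one_eq_two (neg_add_cancel 1) _ c.d_p (d_σ 1 X _)))

variable (A) in
/-- The exact triangles of the homotopy category: the triangles which are isomorphic to the
standard triangle of an internal cone. -/
def exactTriangles : Set (Triangle (H0 A)) :=
  {T | ∃ (X Y : A) (f : Hom X Y 0) (hf : d (zero_add 1) f = 0) (c : InternalCone f),
    Nonempty (T ≅ coneTriangle f hf c)}

end H0

/-! ### The dg category of complexes and the Vogel dg category -/

section Complexes

variable (𝔞 : Type u) [Category.{v} 𝔞] [Preadditive 𝔞]

/-- The objects of the dg category of complexes `C_dg(𝔞)`: the cochain complexes in `𝔞`. -/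
structure Cdg where
  cpx : CochainComplex 𝔞 ℤ

open CochainComplex.HomComplex in
instance : DGCategory.{v} (Cdg 𝔞) where
  Hom X Y n := Cochain X.cpx Y.cpx n
  d {X Y n m} _ := (δ_hom ℤ X.cpx Y.cpx n m).toAddMonoidHom
  id X := Cochain.ofHom (𝟙 X.cpx)
  comp f g h := f.comp g h
  add_comp f f' g h := Cochain.add_comp f f' g h
  comp_add f g g' h := Cochain.comp_add f g g' h
  id_comp f := Cochain.id_comp f
  comp_id f := Cochain.comp_id f
  assoc f g k h₁ h₂ h₃ _ := by
    subst h₁ h₂ h₃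
    exact Cochain.comp_assoc f g k rfl rfl rfl
  d_d _ _ f := δ_δ _ _ _ f
  d_comp f g h hp hq hr _ _ := δ_comp f g h _ _ _ hr hp hq

open CochainComplex.HomComplex in
/-- The internal shifts of complexes are the usual shifts `(X[n])ᵖ = Xᵖ⁺ⁿ` (with differential
`(-1)ⁿ d`), where `X → X[n]` and `X[n] → X` are the identities in each degree. -/
instance : DGShift (Cdg 𝔞) where
  shift n X := ⟨X.cpx⟦n⟧⟩
  σ n X := Cochain.mk fun p q _ => (X.cpx.shiftFunctorObjXIso n q p (by lia)).inv
  τ n X := Cochain.mk fun p q _ => (X.cpx.shiftFunctorObjXIso n p q (by lia)).hom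
  d_σ n X m h := by
    refine Cochain.ext _ _ fun p q hpq => ?_
    refine (δ_v _ m h _ p q hpq _ _ rfl rfl).trans ?_
    subst h
    simp [Int.negOnePow_succ, Int.negOnePow_neg, CochainComplex.shiftFunctorObjXIso]
    have e (z : X.cpx.X p ⟶ X.cpx.X (q + n)) : n.negOnePow • z + -n.negOnePow • z = 0 := by
      rw [Units.neg_smul, add_neg_cancel]
    exact e _
  d_τ n X m h := by
    refine Cochain.ext _ _ fun p q hpq => ?_
    refine (δ_v _ m h _ p q hpq _ _ rfl rfl).trans ?_
    subst h
    simp [Int.negOnePow_succ, CochainComplex.shiftFunctorObjXIso]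
    have e (z : X.cpx.X (p + n) ⟶ X.cpx.X q) : z + -n.negOnePow • n.negOnePow • z = 0 := by
      rw [Units.neg_smul, smul_smul, Int.units_mul_self, one_smul, add_neg_cancel]
    exact e _
  σ_τ n X := by
    refine Cochain.ext₀ _ _ fun p => ?_
    refine (Cochain.comp_v _ _ _ p (p - n) p (by lia) (by lia)).trans ?_
    simp
    exact (Cochain.ofHom_v (𝟙 X.cpx) p).symm
  τ_σ n X := by
    refine Cochain.ext₀ _ _ fun p => ?_
    refine (Cochain.comp_v _ _ _ p (p + n) p (by lia) (by lia)).trans ?_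
    simp
    exact (Cochain.ofHom_v (𝟙 (X.cpx⟦n⟧)) p).symm

open CochainComplex.HomComplex in
/-- The dg ideal of bounded morphisms: those with `fᵖ = 0` whenever `|p|` is sufficiently large. -/
def boundedIdeal : DGIdeal (Cdg 𝔞) where
  carrier X Y n :=
    { carrier := {f : Cochain X.cpx Y.cpx n |
        ∃ N : ℕ, ∀ (p q : ℤ) (h : p + n = q), N ≤ |p| → f.v p q h = 0}
      zero_mem' := ⟨0, fun _ _ _ _ => rfl⟩
      add_mem' := by
        rintro f g ⟨N, hf⟩ ⟨M, hg⟩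
        refine ⟨max N M, fun p q h hp => ?_⟩
        push_cast at hp
        rw [Cochain.add_v, hf p q h (by lia), hg p q h (by lia), add_zero]
      neg_mem' := by
        rintro f ⟨N, hf⟩
        exact ⟨N, fun p q h hp => by rw [Cochain.neg_v, hf p q h hp, neg_zero]⟩ }
  d_mem := by
    rintro X Y n m h f ⟨N, hf⟩
    refine ⟨N + 1, fun p q hpq hp => ?_⟩
    push_cast at hp
    refine (δ_v n m h f p q hpq _ _ rfl rfl).trans ?_
    rw [Int.abs_eq_natAbs] at hp
    rw [hf _ _ _ (by rw [Int.abs_eq_natAbs]; omega), hf _ _ _ (by rw [Int.abs_eq_natAbs]; omega)]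
    simp
  mem_comp := by
    rintro X Y Z p q r f g h ⟨N, hf⟩
    refine ⟨N, fun i k hik hi => ?_⟩
    refine (Cochain.comp_v f g h i _ k rfl (by lia)).trans ?_
    rw [hf _ _ _ hi, Limits.zero_comp]
  comp_mem := by
    rintro X Y Z p q r f g h ⟨N, hg⟩
    refine ⟨N + p.natAbs, fun i k hik hi => ?_⟩
    refine (Cochain.comp_v f g h i _ k rfl (by lia)).trans ?_
    rw [Int.abs_eq_natAbs] at hi
    rw [hg _ _ _ (by rw [Int.abs_eq_natAbs]; omega), Limits.comp_zero]

/-- The Vogel dg category `V(𝔞)`: the factor dg category of `C_dg(𝔞)` by the bounded morphisms. -/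
abbrev Vogel := Factor (boundedIdeal 𝔞)

variable {𝔞} in
/-- The complex `X` is bounded-above: `Xᵖ = 0` for `p` sufficiently large. -/
def IsBoundedAbove (X : CochainComplex 𝔞 ℤ) : Prop := ∃ n : ℤ, ∀ p : ℤ, n < p → IsZero (X.X p)

variable {𝔞} in
/-- The complex `X` is bounded-below: `Xᵖ = 0` for `-p` sufficiently large. -/
def IsBoundedBelow (X : CochainComplex 𝔞 ℤ) : Prop := ∃ n : ℤ, ∀ p : ℤ, p < n → IsZero (X.X p)

variable {𝔞} in
/-- The complex `X` is bounded. -/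
def IsBounded (X : CochainComplex 𝔞 ℤ) : Prop := IsBoundedAbove X ∧ IsBoundedBelow X

/-- `V⁻(𝔞)`, the full dg subcategory of `V(𝔞)` formed by the bounded-above complexes. -/
abbrev VogelMinus := FullDG fun X : Vogel 𝔞 => IsBoundedAbove X.as.cpx

/-- `V⁺(𝔞)`, the full dg subcategory of `V(𝔞)` formed by the bounded-below complexes. -/
abbrev VogelPlus := FullDG fun X : Vogel 𝔞 => IsBoundedBelow X.as.cpx

variable {𝔞} in
theorem IsBoundedAbove.shift {X : CochainComplex 𝔞 ℤ} (hX : IsBoundedAbove X) (k : ℤ) :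
    IsBoundedAbove (X⟦k⟧) := by
  obtain ⟨n, hn⟩ := hX
  exact ⟨n - k, fun p hp => hn (p + k) (by lia)⟩

variable {𝔞} in
theorem IsBoundedBelow.shift {X : CochainComplex 𝔞 ℤ} (hX : IsBoundedBelow X) (k : ℤ) :
    IsBoundedBelow (X⟦k⟧) := by
  obtain ⟨n, hn⟩ := hX
  exact ⟨n - k, fun p hp => hn (p + k) (by lia)⟩

variable {𝔞} in
theorem IsBounded.shift {X : CochainComplex 𝔞 ℤ} (hX : IsBounded X) (k : ℤ) :
    IsBounded (X⟦k⟧) := ⟨hX.1.shift k, hX.2.shift k⟩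

instance : DGShift (VogelMinus 𝔞) := FullDG.dgShift _ fun n _ hX => hX.shift n

instance : DGShift (VogelPlus 𝔞) := FullDG.dgShift _ fun n _ hX => hX.shift n

/-! ### The homotopy categories of complexes and their Verdier quotients -/

/-- The homotopy category `K(𝔞)` of complexes. -/
abbrev K := HomotopyCategory 𝔞 (ComplexShape.up ℤ)

/-- The objects of `K(𝔞)` given by the bounded-above complexes. -/
def boundedAbove : ObjectProperty (K 𝔞) := fun X => IsBoundedAbove X.as

/-- The objects of `K(𝔞)` given by the bounded-below complexes. -/
def boundedBelow : ObjectProperty (K 𝔞) := fun X => IsBoundedBelow X.as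

/-- The objects of `K(𝔞)` given by the bounded complexes. -/
def bounded : ObjectProperty (K 𝔞) := fun X => IsBounded X.as

/-- The full subcategory `K⁻(𝔞)` of `K(𝔞)`. -/
abbrev KMinus := (boundedAbove 𝔞).FullSubcategory

/-- The full subcategory `K⁺(𝔞)` of `K(𝔞)`. -/
abbrev KPlus := (boundedBelow 𝔞).FullSubcategory

variable {𝔞} in
open CochainComplex.HomComplex in
/-- The canonical functor from complexes in `𝔞` to `H⁰(V(𝔞))`, which is the identity on objects and
sends a cochain map to its class. -/
def fromComplexes : CochainComplex 𝔞 ℤ ⥤ H0 (Vogel 𝔞) where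
  obj X := ⟨⟨⟨X⟩⟩⟩
  map f := H0.homMk (X := (⟨⟨_⟩⟩ : Vogel 𝔞)) (Y := (⟨⟨_⟩⟩ : Vogel 𝔞))
    (QuotientAddGroup.mk (Cochain.ofHom f)) (congrArg QuotientAddGroup.mk (δ_ofHom f))
  map_id _ := rfl
  map_comp f g := by
    exact H0.homMk_congr (congrArg QuotientAddGroup.mk (Cochain.ofHom_comp f g)) _ _

open CochainComplex.HomComplex in
/-- The canonical functor `K(𝔞) ⥤ H⁰(V(𝔞))` induced by the projection `C_dg(𝔞) → V(𝔞)`. -/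
def fromK : K 𝔞 ⥤ H0 (Vogel 𝔞) :=
  CategoryTheory.Quotient.lift _ fromComplexes (by
    rintro X Y f g ⟨h⟩
    refine ((H0.cls_eq_iff _ _ _ _).2 ⟨QuotientAddGroup.mk (Cochain.ofHomotopy h), ?_⟩).symm
    exact congrArg QuotientAddGroup.mk (δ_ofHomotopy h))

/-- The canonical functor `K⁻(𝔞) ⥤ H⁰(V⁻(𝔞))`, the restriction of `K(𝔞) ⥤ H⁰(V(𝔞))`. -/
def fromKMinus : KMinus 𝔞 ⥤ H0 (VogelMinus 𝔞) where
  obj X := ⟨⟨⟨⟨X.obj.as⟩⟩, X.property⟩⟩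
  map f := (fromK 𝔞).map f.hom
  map_id X := (fromK 𝔞).map_id X.obj
  map_comp f g := (fromK 𝔞).map_comp f.hom g.hom

/-- The canonical functor `K⁺(𝔞) ⥤ H⁰(V⁺(𝔞))`, the restriction of `K(𝔞) ⥤ H⁰(V(𝔞))`. -/
def fromKPlus : KPlus 𝔞 ⥤ H0 (VogelPlus 𝔞) where
  obj X := ⟨⟨⟨⟨X.obj.as⟩⟩, X.property⟩⟩
  map f := (fromK 𝔞).map f.hom
  map_id X := (fromK 𝔞).map_id X.obj
  map_comp f g := (fromK 𝔞).map_comp f.hom g.hom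

variable {𝔞} in
theorem IsBounded.of_isZero {X : CochainComplex 𝔞 ℤ} (hX : IsZero X) : IsBounded X :=
  ⟨⟨0, fun p _ => (HomologicalComplex.eval 𝔞 _ p).map_isZero hX⟩,
    ⟨0, fun p _ => (HomologicalComplex.eval 𝔞 _ p).map_isZero hX⟩⟩

variable {𝔞} in
theorem IsBoundedAbove.mappingCone [HasBinaryBiproducts 𝔞] {X Y : CochainComplex 𝔞 ℤ} (f : X ⟶ Y)
    (hX : IsBoundedAbove X) (hY : IsBoundedAbove Y) :
    IsBoundedAbove (CochainComplex.mappingCone f) := by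
  obtain ⟨n, hn⟩ := hX
  obtain ⟨m, hm⟩ := hY
  refine ⟨max n m, fun p hp => ?_⟩
  rw [CochainComplex.mappingCone.isZero_X_iff]
  exact ⟨hn _ (by lia), hm _ (by lia)⟩

variable {𝔞} in
theorem IsBoundedBelow.mappingCone [HasBinaryBiproducts 𝔞] {X Y : CochainComplex 𝔞 ℤ} (f : X ⟶ Y)
    (hX : IsBoundedBelow X) (hY : IsBoundedBelow Y) :
    IsBoundedBelow (CochainComplex.mappingCone f) := by
  obtain ⟨n, hn⟩ := hX
  obtain ⟨m, hm⟩ := hY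
  refine ⟨min (n - 1) m, fun p hp => ?_⟩
  rw [CochainComplex.mappingCone.isZero_X_iff]
  exact ⟨hn _ (by lia), hm _ (by lia)⟩

end Complexes

section Verdier

variable (𝔞 : Type u) [Category.{v} 𝔞] [Preadditive 𝔞] [HasZeroObject 𝔞] [HasBinaryBiproducts 𝔞]

open ZeroObject in
/-- A class of complexes which contains the zero complexes and is closed under shifts and mapping
cones defines a triangulated subcategory of the homotopy category. -/
theorem isTriangulated_of_cone (Q : CochainComplex 𝔞 ℤ → Prop) (h₀ : ∀ X, IsZero X → Q X)
    (h₁ : ∀ X (k : ℤ), Q X → Q (X⟦k⟧))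
    (h₂ : ∀ X Y (f : X ⟶ Y), Q X → Q Y → Q (CochainComplex.mappingCone f)) :
    ObjectProperty.IsTriangulated (C := K 𝔞) (fun X => Q X.as) :=
  letI P : ObjectProperty (K 𝔞) := fun X => Q X.as
  haveI : P.ContainsZero := ⟨⟨(HomotopyCategory.quotient _ _).obj
    (0 : CochainComplex 𝔞 ℤ), Functor.map_isZero _ (isZero_zero _), h₀ _ (isZero_zero _)⟩⟩
  haveI : P.IsStableUnderShift ℤ := ⟨fun n => ⟨fun X hX => by
    obtain ⟨X : CochainComplex 𝔞 ℤ, rfl⟩ := X.quotient_obj_surjective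
    rw [ObjectProperty.prop_shift_iff, HomotopyCategory.shift_quotient_obj]
    exact h₁ X n hX⟩⟩
  haveI : P.IsTriangulatedClosed₃ := ⟨by
    intro T hT hX hY
    obtain ⟨f : T.obj₁.as ⟶ T.obj₂.as, hf⟩ :=
      (HomotopyCategory.quotient _ _).map_surjective T.mor₁
    exact ⟨_, h₂ _ _ f hX hY,
      ⟨Triangle.π₃.mapIso (isoTriangleOfIso₁₂ T _ hT
        (HomotopyCategory.mappingCone_triangleh_distinguished f)
        (Iso.refl _) (Iso.refl _)
          ((Category.comp_id _).trans (hf.symm.trans (Category.id_comp _).symm)))⟩⟩⟩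
  { toIsTriangulatedClosed₂ := .of_isTriangulatedClosed₃ }

instance : (boundedAbove 𝔞).IsTriangulated :=
  isTriangulated_of_cone 𝔞 IsBoundedAbove (fun _ hX => (IsBounded.of_isZero hX).1)
    (fun _ k hX => hX.shift k) (fun _ _ f hX hY => hX.mappingCone f hY)

instance : (boundedBelow 𝔞).IsTriangulated :=
  isTriangulated_of_cone 𝔞 IsBoundedBelow (fun _ hX => (IsBounded.of_isZero hX).2)
    (fun _ k hX => hX.shift k) (fun _ _ f hX hY => hX.mappingCone f hY)

instance : (bounded 𝔞).IsTriangulated :=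
  isTriangulated_of_cone 𝔞 IsBounded (fun _ hX => IsBounded.of_isZero hX)
    (fun _ k hX => hX.shift k)
    (fun _ _ f hX hY => ⟨hX.1.mappingCone f hY.1, hX.2.mappingCone f hY.2⟩)

/-- A triangulated subcategory `Q` contained in another one `P` is a triangulated subcategory
of `P`. -/
theorem isTriangulated_inverseImage_ι {T : Type*} [Category* T] [HasZeroObject T] [HasShift T ℤ]
    [Preadditive T] [∀ n : ℤ, (shiftFunctor T n).Additive] [Pretriangulated T]
    (P Q : ObjectProperty T) [P.IsTriangulated] [Q.IsTriangulated] (h : Q ≤ P) :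
    (Q.inverseImage P.ι).IsTriangulated :=
  letI R := Q.inverseImage P.ι
  haveI : R.ContainsZero := by
    obtain ⟨Z, hZ, hQ⟩ := Q.exists_prop_of_containsZero
    refine ⟨⟨⟨Z, h _ hQ⟩, ?_, hQ⟩⟩
    rw [IsZero.iff_id_eq_zero]
    exact P.ι.map_injective (hZ.eq_of_src _ _)
  haveI : R.IsStableUnderShift ℤ := ⟨fun n => ⟨fun X hX => by
    have e : ((shiftFunctor P.FullSubcategory n).obj X).obj = (shiftFunctor T n).obj X.obj := by
      delta ObjectProperty.hasShift
      rfl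
    change Q ((shiftFunctor P.FullSubcategory n).obj X).obj
    rw [e]
    exact Q.le_shift n X.obj hX⟩⟩
  haveI : R.IsTriangulatedClosed₂ := ⟨by
    intro X hX h₁ h₃
    obtain ⟨Y, hY, ⟨e⟩⟩ := Q.ext_of_isTriangulatedClosed₂' _ (P.ι.map_distinguished X hX) h₁ h₃
    exact ⟨⟨Y, h _ hY⟩, hY, ⟨P.fullyFaithfulι.preimageIso e⟩⟩⟩
  { }

/-- The bounded complexes, as a triangulated subcategory `Kᵇ(𝔞)` of `K⁻(𝔞)`. -/
def boundedInMinus : ObjectProperty (KMinus 𝔞) := (bounded 𝔞).inverseImage (boundedAbove 𝔞).ι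

/-- The bounded complexes, as a triangulated subcategory `Kᵇ(𝔞)` of `K⁺(𝔞)`. -/
def boundedInPlus : ObjectProperty (KPlus 𝔞) := (bounded 𝔞).inverseImage (boundedBelow 𝔞).ι

instance : (boundedInMinus 𝔞).IsTriangulated :=
  isTriangulated_inverseImage_ι _ _ fun _ hX => hX.1

instance : (boundedInPlus 𝔞).IsTriangulated :=
  isTriangulated_inverseImage_ι _ _ fun _ hX => hX.2

end Verdier

/-- The Verdier quotient of a triangulated category by a triangulated subcategory `P`: the
localization at the morphisms whose cone is isomorphic to an object of `P`. -/
abbrev VerdierQuotient {T : Type u} [Category.{v} T] [HasZeroObject T] [HasShift T ℤ]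
    [Preadditive T] [∀ n : ℤ, (shiftFunctor T n).Additive] [Pretriangulated T]
    (P : ObjectProperty T) := P.trW.Localization

/-! ### Triangulated categories and decompositions -/

/-- The category `C`, with its shift and the class `𝒯` of exact triangles, is a triangulated
category (including the octahedral axiom). -/
def IsTriangulatedCategory (C : Type u) [Category.{v} C] [Preadditive C] [HasShift C ℤ]
    (𝒯 : Set (Triangle C)) : Prop :=
  ∃ (_ : HasZeroObject C) (_ : ∀ n : ℤ, (shiftFunctor C n).Additive) (_ : Pretriangulated C),
    distTriang C = 𝒯 ∧ IsTriangulated C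

section

variable {C : Type*} [Category* C] [Preadditive C] [HasShift C ℤ]
  {D : Type*} [Category* D] [Preadditive D] [HasShift D ℤ]
  {E : Type*} [Category* E] [Preadditive E] [HasShift E ℤ]

/-- The functor `F` identifies `C`, with the class `𝒮` of exact triangles, with a full triangulated
subcategory of `D`, with the class `𝒯` of exact triangles: it is fully faithful, and it commutes
with the shifts in such a way that a triangle in `C` is exact if and only if its image is exact. -/
structure IsTriangleEmbedding (F : C ⥤ D) (𝒮 : Set (Triangle C)) (𝒯 : Set (Triangle D)) :
    Prop where
  full : F.Full
  faithful : F.Faithful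
  exact_iff : ∃ _ : F.CommShift ℤ, ∀ T : Triangle C, T ∈ 𝒮 ↔ F.mapTriangle.obj T ∈ 𝒯

/-- The functor `F` is an isomorphism of triangulated categories: a triangle functor which is
fully faithful and bijective on objects. -/
structure IsTriangleIsomorphism (F : C ⥤ D) (𝒮 : Set (Triangle C)) (𝒯 : Set (Triangle D)) :
    Prop extends IsTriangleEmbedding F 𝒮 𝒯 where
  bijective : Function.Bijective F.obj

/-- A semi-orthogonal decomposition `E = ⟨C, D⟩` of a triangulated category into two full
triangulated subcategories, given by their inclusion functors `i` and `j`. -/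
structure IsSemiorthogonalDecomposition (i : C ⥤ E) (j : D ⥤ E) (𝒮 : Set (Triangle C))
    (𝒮' : Set (Triangle D)) (𝒯 : Set (Triangle E)) : Prop where
  embedding_left : IsTriangleEmbedding i 𝒮 𝒯
  embedding_right : IsTriangleEmbedding j 𝒮' 𝒯
  hom_eq_zero : ∀ (Y : D) (X : C) (f : j.obj Y ⟶ i.obj X), f = 0
  exists_triangle : ∀ Z : E, ∃ (Y : D) (X : C) (f : j.obj Y ⟶ Z) (g : Z ⟶ i.obj X)
    (h : i.obj X ⟶ (j.obj Y)⟦(1 : ℤ)⟧), Triangle.mk f g h ∈ 𝒯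

/-- An orthogonal decomposition `E = C × D`: a semi-orthogonal decomposition such that there are no
nonzero morphisms from `C` to `D` either. -/
structure IsOrthogonalDecomposition (i : C ⥤ E) (j : D ⥤ E) (𝒮 : Set (Triangle C))
    (𝒮' : Set (Triangle D)) (𝒯 : Set (Triangle E)) : Prop
    extends IsSemiorthogonalDecomposition i j 𝒮 𝒮' 𝒯 where
  hom_eq_zero' : ∀ (X : C) (Y : D) (f : i.obj X ⟶ j.obj Y), f = 0

end

end VogelDG

end

open VogelDG

/-!
Modulo bounded morphisms, a closed morphism of degree zero is a cochain map in all degrees of large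
absolute value, and a complex is isomorphic to its brutal restriction to those degrees. So the
mapping cones of cochain maps between restrictions provide internal cones in `V(𝔞)`, and the
homotopy category of any dg category with shifts and internal cones is triangulated.

Every homogeneous morphism between a bounded-above and a bounded-below complex is bounded, whence
the orthogonality, and a complex is in `H⁰(V(𝔞))` the biproduct of its restrictions to the
nonnegative and to the negative degrees.

A closed bounded cochain `X → Y`, with `Y` bounded above or `X` bounded below, factors through a
bounded complex `W`. If it is of degree `1` and the differential of a representative of a morphism
of `V(𝔞)`, then that representative is corrected to a cochain map to the mapping cone of `W → Y`,
so the functor from the Verdier quotient is full; if it is a cochain map, it vanishes in the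
Verdier quotient, so the functor is faithful.
-/

noncomputable section

namespace VogelDG

open DGCategory DGShift

section Points

variable {A : Type u} [DGCategory.{w} A]

/-- The generalised elements of `X`: the families of homogeneous morphisms to `X` of all degrees.
Homogeneous morphisms act on them regardless of degree, so that identities between composites can be
checked in abelian groups, without indexing by degrees. -/
abbrev Points (X : A) : Type max u w := ∀ (W : A) (m : ℤ), Hom W X m

namespace Points

/-- The action of a homogeneous morphism on generalised elements, by postcomposition. -/
def map {X Y : A} {n : ℤ} (f : Hom X Y n) : Points X →+ Points Y :=
  AddMonoidHom.mk' (fun x W m => comp (x W (m - n)) f (sub_add_cancel m n))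
    fun _ _ => funext fun _ => funext fun _ => add_comp _ _ _ _

/-- The differential of generalised elements. -/
def diff {X : A} : Points X →+ Points X :=
  AddMonoidHom.mk' (fun x W m => d (sub_add_cancel m 1) (x W (m - 1)))
    fun _ _ => funext fun _ => funext fun _ => map_add _ _ _

variable {X Y Z : A}

theorem map_apply {n : ℤ} (f : Hom X Y n) (x : Points X) {W : A} {k m : ℤ} (h : k + n = m) :
    map f x W m = comp (x W k) f h := by
  obtain rfl : k = m - n := by lia
  rfl

theorem diff_apply (x : Points X) {W : A} {k m : ℤ} (h : k + 1 = m) :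
    diff x W m = d h (x W k) := by
  obtain rfl : k = m - 1 := by lia
  rfl

theorem hom_ext {n : ℤ} {f g : Hom X Y n} (h : ∀ x : Points X, map f x = map g x) : f = g := by
  classical
  let x : Points X := fun W m =>
    if e : X = W ∧ 0 = m then e.1 ▸ e.2 ▸ DGCategory.id X else 0
  have hx : x X 0 = DGCategory.id X := by simp [x]
  have e : map f x X n = map g x X n := by rw [h]
  rwa [map_apply f x (zero_add n), map_apply g x (zero_add n), hx, id_comp, id_comp] at e

@[simp]
theorem map_comp {p q r : ℤ} (f : Hom X Y p) (g : Hom Y Z q) (h : p + q = r) (x : Points X) :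
    map (comp f g h) x = map g (map f x) := by
  funext W m
  rw [map_apply _ _ (sub_add_cancel m r), map_apply g _ (sub_add_cancel m q),
    map_apply f _ (show m - r + p = m - q by lia), assoc]

@[simp]
theorem map_id (x : Points X) : map (DGCategory.id X) x = x := by
  funext W m
  rw [map_apply _ _ (add_zero m), comp_id]

@[simp]
theorem map_hom_add {n : ℤ} (f g : Hom X Y n) (x : Points X) :
    map (f + g) x = map f x + map g x :=
  funext fun _ => funext fun _ => comp_add _ _ _ _

@[simp]
theorem map_hom_sub {n : ℤ} (f g : Hom X Y n) (x : Points X) :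
    map (f - g) x = map f x - map g x :=
  funext fun _ => funext fun _ => comp_sub _ _ _ _

@[simp]
theorem map_hom_zero {n : ℤ} (x : Points X) : map (0 : Hom X Y n) x = 0 :=
  funext fun _ => funext fun _ => comp_zero _ _

@[simp]
theorem map_hom_neg {n : ℤ} (f : Hom X Y n) (x : Points X) : map (-f) x = -map f x := by
  rw [← zero_sub, map_hom_sub, map_hom_zero, zero_sub]

theorem diff_map {n m : ℤ} (f : Hom X Y n) (h : n + 1 = m) (x : Points X) :
    diff (map f x) = map (d h f) x + n.negOnePow • map f (diff x) := by
  funext W k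
  change _ = map (d h f) x W k + n.negOnePow • map f (diff x) W k
  rw [diff_apply _ (sub_add_cancel k 1), map_apply f _ (sub_add_cancel (k - 1) n),
    map_apply (d h f) _ (show k - 1 - n + m = k by lia), map_apply f _ (sub_add_cancel k n),
    diff_apply _ (show k - 1 - n + 1 = k - n by lia),
    d_comp _ _ _ (show k - 1 - n + 1 = k - n by lia) h _ (by lia) (by lia)]

theorem diff_map_of_closed {n m : ℤ} {f : Hom X Y n} {h : n + 1 = m} (hf : d h f = 0)
    (x : Points X) : diff (map f x) = n.negOnePow • map f (diff x) := by
  rw [diff_map f h, hf, map_hom_zero, zero_add]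

theorem diff_map_of_cocycle {f : Hom X Y 0} (hf : d (zero_add 1) f = 0) (x : Points X) :
    diff (map f x) = map f (diff x) := by
  simp [diff_map_of_closed hf]

theorem d_eq_of_diff_map {n m : ℤ} {f : Hom X Y n} {g : Hom X Y m} (h : n + 1 = m)
    (e : ∀ x, diff (map f x) = map g x + n.negOnePow • map f (diff x)) : d h f = g :=
  hom_ext fun x => add_right_cancel ((diff_map f h x).symm.trans (e x))

theorem d_eq_zero_of_diff_map {n m : ℤ} {f : Hom X Y n} (h : n + 1 = m)
    (e : ∀ x, diff (map f x) = n.negOnePow • map f (diff x)) : d h f = 0 :=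
  d_eq_of_diff_map h fun x => by rw [e, map_hom_zero, zero_add]

end Points

end Points

open Points

namespace InternalCone

variable {A : Type u} [DGCategory.{w} A] {X Y : A} {f : Hom X Y 0} (c : InternalCone f)

@[simp]
theorem map_p_map_j (x : Points Y) : map c.p (map c.j x) = 0 := by
  rw [← map_comp _ _ (zero_add 1), c.j_p, map_hom_zero]

@[simp]
theorem map_t_map_s (x : Points X) : map c.t (map c.s x) = 0 := by
  rw [← map_comp _ _ (add_zero (-1)), c.s_t, map_hom_zero]

@[simp]
theorem map_t_map_j (x : Points Y) : map c.t (map c.j x) = x := by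
  rw [← map_comp _ _ (zero_add 0), c.j_t, map_id]

@[simp]
theorem map_p_map_s (x : Points X) : map c.p (map c.s x) = x := by
  rw [← map_comp _ _ (neg_add_cancel 1), c.s_p, map_id]

@[simp]
theorem map_s_map_p (x : Points c.obj) : map c.s (map c.p x) = x - map c.j (map c.t x) := by
  rw [eq_sub_iff_add_eq, ← map_comp _ _ (add_neg_cancel 1), ← map_comp _ _ (zero_add 0),
    ← map_hom_add, c.id_obj, map_id]

@[simp]
theorem diff_map_j (x : Points Y) : diff (map c.j x) = map c.j (diff x) :=
  diff_map_of_cocycle c.d_j x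

@[simp]
theorem diff_map_p (x : Points c.obj) : diff (map c.p x) = -map c.p (diff x) := by
  simp [diff_map_of_closed c.d_p]

@[simp]
theorem diff_map_s (x : Points X) :
    diff (map c.s x) = map c.j (map f x) - map c.s (diff x) := by
  simp [diff_map c.s (neg_add_cancel 1), c.d_s, sub_eq_add_neg]

@[simp]
theorem diff_map_t (x : Points c.obj) :
    diff (map c.t x) = map c.t (diff x) - map f (map c.p x) := by
  have hx : map c.t (diff (map c.s (map c.p x) + map c.j (map c.t x))) = map c.t (diff x) := by
    simp
  rw [← hx, map_add, diff_map_s, diff_map_j]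
  simp

end InternalCone

namespace H0

variable {A : Type u} [DGCategory.{w} A]

theorem homMk_eq_of_map {X Y : A} {f g : Hom X Y 0}
    {hf : d (zero_add 1) f = 0} {hg : d (zero_add 1) g = 0}
    (h : ∀ x, map f x = map g x) : homMk f hf = homMk g hg :=
  homMk_congr (hom_ext h) _ _

theorem homMk_eq_of_homotopy {X Y : A} {f g : Hom X Y 0}
    {hf : d (zero_add 1) f = 0} {hg : d (zero_add 1) g = 0} (k : Hom X Y (-1))
    (h : ∀ x, diff (map k x) = map g x - map f x - map k (diff x)) : homMk f hf = homMk g hg :=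
  (cls_eq_iff _ _ _ _).2 ⟨k, d_eq_of_diff_map _ fun x => by simp [h, sub_eq_add_neg]⟩

end H0

section Shift

variable {A : Type u} [DGCategory.{w} A] [DGShift A]

@[simp]
theorem map_τ_map_σ (n : ℤ) {X : A} (x : Points X) : map (τ n X) (map (σ n X) x) = x := by
  rw [← map_comp _ _ (neg_add_cancel n), σ_τ, map_id]

@[simp]
theorem map_σ_map_τ (n : ℤ) {X : A} (x : Points (DGShift.shift n X)) :
    map (σ n X) (map (τ n X) x) = x := by
  rw [← map_comp _ _ (add_neg_cancel n), τ_σ, map_id]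

@[simp]
theorem diff_map_σ (n : ℤ) {X : A} (x : Points X) :
    diff (map (σ n X) x) = n.negOnePow • map (σ n X) (diff x) := by
  rw [diff_map_of_closed (d_σ n X rfl), Int.negOnePow_neg]

@[simp]
theorem diff_map_τ (n : ℤ) {X : A} (x : Points (DGShift.shift n X)) :
    diff (map (τ n X) x) = n.negOnePow • map (τ n X) (diff x) :=
  diff_map_of_closed (d_τ n X rfl) x

namespace H0

@[simp]
theorem map_shiftHom (n : ℤ) {X Y : A} (f : Hom X Y 0) (x : Points (DGShift.shift n X)) :
    map (shiftHom n f) x = map (σ n Y) (map f (map (τ n X) x)) := by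
  simp [shiftHom]

/-- The identification of `X[m][n]` with `X[n][m]`, through the structure morphisms to `X`. -/
def shiftCommHom (m n : ℤ) (X : A) :
    Hom (DGShift.shift n (DGShift.shift m X)) (DGShift.shift m (DGShift.shift n X)) 0 :=
  DGCategory.comp (DGCategory.comp (τ n (DGShift.shift m X)) (τ m X) rfl)
    (DGCategory.comp (σ n X) (σ m (DGShift.shift n X)) rfl) (by lia)

theorem d_shiftCommHom (m n : ℤ) (X : A) : d (zero_add 1) (shiftCommHom m n X) = 0 :=
  d_comp_eq_zero _ _ _ rfl rfl _
    (d_comp_eq_zero _ _ _ rfl rfl _ (d_τ _ _ _) (d_τ _ _ _))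
    (d_comp_eq_zero _ _ _ rfl rfl _ (d_σ _ _ _) (d_σ _ _ _))

theorem shiftFunctorComm_hom_app (m n : ℤ) (X : A) :
    (shiftFunctorComm (H0 A) m n).hom.app ⟨X⟩ =
      homMk (shiftCommHom m n X) (d_shiftCommHom m n X) := by
  have hswap : (shiftFunctorAdd' (H0 A) n m (m + n) (add_comm n m)).hom.app ⟨X⟩ =
      eqToHom (congrArg (fun k => (⟨DGShift.shift k X⟩ : H0 A)) (add_comm m n)) ≫
        homMk (shiftAddHom n m X) (d_shiftAddHom n m X) := by
    simp only [shiftFunctorAdd', Iso.trans_hom, NatTrans.comp_app, eqToIso.hom, eqToHom_app]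
    rfl
  have hcomm : (shiftFunctorComm (H0 A) m n).hom.app ⟨X⟩ =
      homMk (shiftAddInv m n X) (d_shiftAddInv m n X) ≫
        (shiftFunctorAdd' (H0 A) n m (m + n) (add_comm n m)).hom.app ⟨X⟩ := rfl
  rw [hcomm, hswap, eqToHom_shift (add_comm m n)]
  exact homMk_congr (g := shiftCommHom m n X) (f := DGCategory.comp (shiftAddInv m n X)
    (DGCategory.comp (DGCategory.comp (τ (m + n) X) (σ (n + m) X) (by lia))
      (shiftAddHom n m X) (zero_add 0)) (zero_add 0))
    (hom_ext fun x => by simp [shiftCommHom, shiftAddHom, shiftAddInv]) _ _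

instance (n : ℤ) : (shiftFunctor (H0 A) n).Additive where
  map_add := by
    rintro X Y ⟨f, hf⟩ ⟨g, hg⟩
    exact homMk_eq_of_map (f := shiftHom n (f + g)) (g := shiftHom n f + shiftHom n g)
      (hf := d_shiftHom _ _ ((cocycles _ _).add_mem hf hg))
      (hg := (cocycles _ _).add_mem (d_shiftHom _ _ hf) (d_shiftHom _ _ hg)) fun x => by simp

end H0

end Shift

section Cones

/-- The isomorphism of triangles given by an isomorphism of the third objects. -/
def triangleIsoMk₃ {C : Type*} [Category* C] [HasShift C ℤ] {X Y Z Z' : C} {f f' : X ⟶ Y}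
    {g : Y ⟶ Z} {g' : Y ⟶ Z'} {h : Z ⟶ X⟦(1 : ℤ)⟧} {h' : Z' ⟶ X⟦(1 : ℤ)⟧} (e : Z ≅ Z')
    (h₁ : f = f') (h₂ : g ≫ e.hom = g') (h₃ : h = e.hom ≫ h') :
    Triangle.mk f g h ≅ Triangle.mk f' g' h' :=
  Triangle.isoMk _ _ (Iso.refl X) (Iso.refl Y) e
    ((Category.comp_id f).trans (h₁.trans (Category.id_comp f').symm))
    (h₂.trans (Category.id_comp g').symm)
    ((congrArg (h ≫ ·) (CategoryTheory.Functor.map_id _ X)).trans ((Category.comp_id h).trans h₃))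

variable {A : Type u} [DGCategory.{w} A]

/-- Every closed morphism of degree zero has an internal cone. -/
class HasInternalCones (A : Type u) [DGCategory.{w} A] : Prop where
  exists_cone : ∀ {X Y : A} (f : Hom X Y 0), d (zero_add 1) f = 0 → Nonempty (InternalCone f)

theorem InternalCone.isZero {X : A} (c : InternalCone (DGCategory.id X)) :
    IsZero (⟨c.obj⟩ : H0 A) := by
  rw [IsZero.iff_id_eq_zero]
  refine (H0.homMk_eq_of_homotopy (f := 0) (g := DGCategory.id c.obj) (hf := map_zero _)
    (hg := d_id _ _) (DGCategory.comp c.t c.s (zero_add (-1))) fun x => ?_).symm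
  simp
  abel

instance [HasInternalCones A] [Nonempty A] : HasZeroObject (H0 A) :=
  let X : A := Classical.arbitrary A
  ⟨_, (HasInternalCones.exists_cone (DGCategory.id X) (d_id _ _)).some.isZero⟩

variable {X Y X' Y' : A} {f : Hom X Y 0} {f' : Hom X' Y' 0}

/-- The morphism of internal cones given by a square which commutes up to the homotopy `k`. -/
def coneMap (c : InternalCone f) (c' : InternalCone f') (a : Hom X X' 0) (b : Hom Y Y' 0)
    (k : Hom X Y' (-1)) : Hom c.obj c'.obj 0 :=
  DGCategory.comp (DGCategory.comp c.t b (zero_add 0)) c'.j (zero_add 0) +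
    DGCategory.comp (DGCategory.comp c.p a (add_zero 1)) c'.s (add_neg_cancel 1) +
    DGCategory.comp (DGCategory.comp c.p k (add_neg_cancel 1)) c'.j (zero_add 0)

theorem d_coneMap (c : InternalCone f) (c' : InternalCone f') {a : Hom X X' 0} {b : Hom Y Y' 0}
    {k : Hom X Y' (-1)} (ha : d (zero_add 1) a = 0) (hb : d (zero_add 1) b = 0)
    (hk : d (neg_add_cancel 1) k = DGCategory.comp f b (zero_add 0) -
      DGCategory.comp a f' (zero_add 0)) :
    d (zero_add 1) (coneMap c c' a b k) = 0 := by
  refine d_eq_zero_of_diff_map _ fun x => ?_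
  simp [coneMap, diff_map_of_cocycle ha, diff_map_of_cocycle hb, diff_map k (neg_add_cancel 1), hk]
  abel

section

variable [DGShift A]

/-- The homotopy equivalence from the internal cone of the inclusion `j` to `X[1]`. -/
def rotateHom (c : InternalCone f) (c' : InternalCone c.j) : Hom c'.obj (DGShift.shift 1 X) 0 :=
  -DGCategory.comp (DGCategory.comp c'.t c.p (zero_add 1)) (σ 1 X) (add_neg_cancel 1)

/-- The homotopy inverse of `rotateHom`. -/
def rotateInv (c : InternalCone f) (c' : InternalCone c.j) : Hom (DGShift.shift 1 X) c'.obj 0 :=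
  DGCategory.comp (τ 1 X) (DGCategory.comp f c'.s (zero_add (-1)) -
    DGCategory.comp c.s c'.j (add_zero (-1))) (add_neg_cancel 1)

theorem d_p_σ (c : InternalCone f) :
    d (zero_add 1) (DGCategory.comp c.p (σ 1 X) (add_neg_cancel 1)) = 0 :=
  d_comp_eq_zero _ _ _ one_add_one_eq_two (neg_add_cancel 1) _ c.d_p (d_σ 1 X _)

theorem d_rotateHom (c : InternalCone f) (c' : InternalCone c.j) :
    d (zero_add 1) (rotateHom c c') = 0 :=
  d_eq_zero_of_diff_map _ fun x => by simp [rotateHom]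

theorem d_rotateInv (c : InternalCone f) (c' : InternalCone c.j) (hf : d (zero_add 1) f = 0) :
    d (zero_add 1) (rotateInv c c') = 0 :=
  d_eq_zero_of_diff_map _ fun x => by simp [rotateInv, diff_map_of_cocycle hf]

namespace H0

/-- The internal cone of the inclusion `j` is isomorphic to `X[1]` in the homotopy category. -/
def rotateIso (c : InternalCone f) (c' : InternalCone c.j) (hf : d (zero_add 1) f = 0) :
    (⟨c'.obj⟩ : H0 A) ≅ ⟨DGShift.shift 1 X⟩ where
  hom := homMk (rotateHom c c') (d_rotateHom c c')
  inv := homMk (rotateInv c c') (d_rotateInv c c' hf)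
  hom_inv_id := homMk_eq_of_homotopy
    (DGCategory.comp (DGCategory.comp c'.t c.t (zero_add 0)) c'.s (zero_add (-1)))
    fun x => by simp [rotateHom, rotateInv]; abel
  inv_hom_id := homMk_eq_of_map fun x => by simp [rotateHom, rotateInv]

theorem j_rotateHom (c : InternalCone f) (c' : InternalCone c.j) :
    homMk c'.j c'.d_j ≫ homMk (rotateHom c c') (d_rotateHom c c') =
      -homMk (DGCategory.comp c.p (σ 1 X) (add_neg_cancel 1)) (d_p_σ c) :=
  homMk_eq_of_map fun x => by simp [rotateHom]

theorem rotateHom_shiftHom (c : InternalCone f) (c' : InternalCone c.j)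
    (hf : d (zero_add 1) f = 0) :
    homMk (rotateHom c c') (d_rotateHom c c') ≫ homMk (shiftHom 1 f) (d_shiftHom 1 f hf) =
      homMk (DGCategory.comp c'.p (σ 1 Y) (add_neg_cancel 1)) (d_p_σ c') :=
  homMk_eq_of_homotopy (DGCategory.comp (DGCategory.comp c'.t c.t (zero_add 0)) (σ 1 Y)
    (zero_add (-1))) fun x => by simp [rotateHom]; abel

/-- The rotation of a standard triangle is isomorphic to a standard triangle. -/
def rotateTriangleIso (c : InternalCone f) (c' : InternalCone c.j) (hf : d (zero_add 1) f = 0) :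
    coneTriangle c.j c.d_j c' ≅ (coneTriangle f hf c).rotate :=
  triangleIsoMk₃ (rotateIso c c' hf) rfl (j_rotateHom c c')
    ((congrArg Neg.neg (rotateHom_shiftHom c c' hf).symm).trans (Preadditive.comp_neg _ _).symm)

end H0

/-- The internal cone of the negative of a shifted morphism; the signs are those of the shift of
triangles. -/
def InternalCone.shift (c : InternalCone f) : InternalCone (-H0.shiftHom (-1) f) where
  obj := DGShift.shift (-1) c.obj
  j := -H0.shiftHom (-1) c.j
  t := -H0.shiftHom (-1) c.t
  p := -DGCategory.comp (DGCategory.comp (τ (-1) c.obj) c.p (neg_add_cancel 1)) (σ (-1) X)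
    (zero_add 1)
  s := -DGCategory.comp (DGCategory.comp (τ (-1) X) c.s rfl) (σ (-1) c.obj) (by lia)
  j_p := hom_ext fun x => by simp
  s_t := hom_ext fun x => by simp
  id_obj := hom_ext fun x => by simp
  j_t := hom_ext fun x => by simp
  s_p := hom_ext fun x => by simp
  d_j := d_eq_zero_of_diff_map _ fun x => by simp
  d_p := d_eq_zero_of_diff_map _ fun x => by simp
  d_s := d_eq_of_diff_map _ fun x => by simp; abel

theorem H0.shift_p_σ (c : InternalCone f) :
    homMk (DGCategory.comp (X := DGShift.shift (-1) c.obj) c.shift.p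
        (σ 1 (DGShift.shift (-1) X)) (add_neg_cancel 1)) (d_p_σ c.shift) =
      homMk (shiftHom (-1) (-DGCategory.comp c.p (σ 1 X) (add_neg_cancel 1)))
        (d_eq_zero_of_diff_map _ fun x => by simp) ≫
      homMk (shiftCommHom 1 (-1) X) (d_shiftCommHom 1 (-1) X) :=
  homMk_eq_of_map fun x => by simp [InternalCone.shift, shiftCommHom]

theorem d_neg_shiftHom (hf : d (zero_add 1) f = 0) :
    d (zero_add 1) (-H0.shiftHom (-1) f) = 0 := by
  rw [map_neg, H0.d_shiftHom _ _ hf, neg_zero]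

/-- The shift of a standard triangle by `-1` is isomorphic to a standard triangle. -/
def H0.shiftTriangleIso (c : InternalCone f) (hf : d (zero_add 1) f = 0) :
    coneTriangle (-shiftHom (-1) f) (d_neg_shiftHom hf) c.shift ≅
      (Triangle.shiftFunctor (H0 A) (-1)).obj (coneTriangle f hf c) :=
  have hneg {U V : H0 A} (z : U ⟶ V) : -z = (-1 : ℤ).negOnePow • z := by simp
  have hcomm := shiftFunctorComm_hom_app (A := A) 1 (-1) X
  triangleIsoMk₃ (Iso.refl _) (hneg (homMk (shiftHom (-1) f) (d_shiftHom (-1) f hf)))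
    ((Category.comp_id _).trans (hneg (homMk (shiftHom (-1) c.j) (d_shiftHom (-1) c.j c.d_j))))
    (by
      refine .trans ?_ (Category.id_comp _).symm
      refine .trans ?_ (hneg _)
      refine congrArg Neg.neg ((shift_p_σ c).trans ?_)
      exact congrArg (_ ≫ ·) hcomm.symm)

end

end Cones

section Pretriangulated

theorem complete_triangle_morphism_of_iso {C : Type*} [Category* C] [HasShift C ℤ]
    {T T' S S' : Triangle C} (e : T ≅ S) (e' : T' ≅ S')
    (h : ∀ (a : S.obj₁ ⟶ S'.obj₁) (b : S.obj₂ ⟶ S'.obj₂), S.mor₁ ≫ b = a ≫ S'.mor₁ →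
      ∃ φ : S.obj₃ ⟶ S'.obj₃, S.mor₂ ≫ φ = b ≫ S'.mor₂ ∧ S.mor₃ ≫ a⟦1⟧' = φ ≫ S'.mor₃)
    (a : T.obj₁ ⟶ T'.obj₁) (b : T.obj₂ ⟶ T'.obj₂) (fac : T.mor₁ ≫ b = a ≫ T'.mor₁) :
    ∃ φ : T.obj₃ ⟶ T'.obj₃, T.mor₂ ≫ φ = b ≫ T'.mor₂ ∧ T.mor₃ ≫ a⟦1⟧' = φ ≫ T'.mor₃ := by
  obtain ⟨φ, h₁, h₂⟩ := h (e.inv.hom₁ ≫ a ≫ e'.hom.hom₁) (e.inv.hom₂ ≫ b ≫ e'.hom.hom₂) (by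
    rw [e.inv.comm₁_assoc, reassoc_of% fac, e'.hom.comm₁, Category.assoc, Category.assoc])
  refine ⟨e.hom.hom₃ ≫ φ ≫ e'.inv.hom₃, ?_, ?_⟩
  · rw [e.hom.comm₂_assoc, reassoc_of% h₁]
    simp
  · rw [Category.assoc, Category.assoc, ← e'.inv.comm₃, ← reassoc_of% h₂,
      ← e.hom.comm₃_assoc, ← Functor.map_comp, ← Functor.map_comp]
    simp

variable {A : Type u} [DGCategory.{w} A]

section

variable {X Y X' Y' : A} {f : Hom X Y 0} {f' : Hom X' Y' 0}

theorem j_coneMap (c : InternalCone f) (c' : InternalCone f') (a : Hom X X' 0) (b : Hom Y Y' 0)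
    (k : Hom X Y' (-1)) : DGCategory.comp c.j (coneMap c c' a b k) (zero_add 0) =
      DGCategory.comp b c'.j (zero_add 0) :=
  hom_ext fun x => by simp [coneMap]

theorem coneMap_p (c : InternalCone f) (c' : InternalCone f') (a : Hom X X' 0) (b : Hom Y Y' 0)
    (k : Hom X Y' (-1)) : DGCategory.comp (coneMap c c' a b k) c'.p (zero_add 1) =
      DGCategory.comp c.p a (add_zero 1) :=
  hom_ext fun x => by simp [coneMap]

end

namespace H0

variable [DGShift A]

theorem mem_exactTriangles_of_iso {T T' : Triangle (H0 A)} (e : T ≅ T')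
    (hT : T' ∈ exactTriangles A) : T ∈ exactTriangles A := by
  obtain ⟨X, Y, f, hf, c, ⟨e'⟩⟩ := hT
  exact ⟨X, Y, f, hf, c, ⟨e ≪≫ e'⟩⟩

theorem coneTriangle_mem {X Y : A} (f : Hom X Y 0) (hf : d (zero_add 1) f = 0)
    (c : InternalCone f) : coneTriangle f hf c ∈ exactTriangles A :=
  ⟨X, Y, f, hf, c, ⟨Iso.refl _⟩⟩

theorem p_σ_shiftHom {X Y X' Y' : A} {f : Hom X Y 0} {f' : Hom X' Y' 0} (c : InternalCone f)
    (c' : InternalCone f') {a : Hom X X' 0} (ha : d (zero_add 1) a = 0) {φ : Hom c.obj c'.obj 0}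
    (hφ : d (zero_add 1) φ = 0)
    (h : DGCategory.comp φ c'.p (zero_add 1) = DGCategory.comp c.p a (add_zero 1)) :
    homMk (DGCategory.comp c.p (σ 1 X) (add_neg_cancel 1)) (d_p_σ c) ≫
        homMk (shiftHom 1 a) (d_shiftHom 1 a ha) =
      homMk φ hφ ≫ homMk (DGCategory.comp c'.p (σ 1 X') (add_neg_cancel 1)) (d_p_σ c') :=
  homMk_eq_of_map fun x => by simp [← map_comp φ c'.p (zero_add 1), h]

theorem exists_coneTriangle_morphism {X Y X' Y' : A} {f : Hom X Y 0} {f' : Hom X' Y' 0}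
    (hf : d (zero_add 1) f = 0) (hf' : d (zero_add 1) f' = 0) (c : InternalCone f)
    (c' : InternalCone f') (a : (⟨X⟩ : H0 A) ⟶ ⟨X'⟩) (b : (⟨Y⟩ : H0 A) ⟶ ⟨Y'⟩)
    (fac : homMk f hf ≫ b = a ≫ homMk f' hf') :
    ∃ φ : (⟨c.obj⟩ : H0 A) ⟶ ⟨c'.obj⟩, (coneTriangle f hf c).mor₂ ≫ φ =
      b ≫ (coneTriangle f' hf' c').mor₂ ∧
      (coneTriangle f hf c).mor₃ ≫ a⟦1⟧' = φ ≫ (coneTriangle f' hf' c').mor₃ := by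
  obtain ⟨a, ha, rfl⟩ := homMk_surjective a
  obtain ⟨b, hb, rfl⟩ := homMk_surjective b
  obtain ⟨k, hk⟩ := (cls_eq_iff _ _ _ _).1 fac.symm
  have hφ := d_coneMap c c' ha hb hk
  refine ⟨homMk (coneMap c c' a b k) hφ, homMk_congr (j_coneMap c c' a b k) _ _, ?_⟩
  exact (Preadditive.neg_comp _ _).trans ((congrArg Neg.neg
    (p_σ_shiftHom c c' ha hφ (coneMap_p c c' a b k))).trans (Preadditive.comp_neg _ _).symm)

theorem exists_triangle_morphism {T T' : Triangle (H0 A)} (hT : T ∈ exactTriangles A)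
    (hT' : T' ∈ exactTriangles A) (a : T.obj₁ ⟶ T'.obj₁) (b : T.obj₂ ⟶ T'.obj₂)
    (fac : T.mor₁ ≫ b = a ≫ T'.mor₁) :
    ∃ φ : T.obj₃ ⟶ T'.obj₃, T.mor₂ ≫ φ = b ≫ T'.mor₂ ∧ T.mor₃ ≫ a⟦1⟧' = φ ≫ T'.mor₃ := by
  obtain ⟨X, Y, f, hf, c, ⟨e⟩⟩ := hT
  obtain ⟨X', Y', f', hf', c', ⟨e'⟩⟩ := hT'
  exact complete_triangle_morphism_of_iso e e'
    (exists_coneTriangle_morphism hf hf' c c') a b fac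

theorem shift_neg_one_mem {T : Triangle (H0 A)} (hT : T ∈ exactTriangles A) :
    (Triangle.shiftFunctor (H0 A) (-1)).obj T ∈ exactTriangles A := by
  obtain ⟨X, Y, f, hf, c, ⟨e⟩⟩ := hT
  exact ⟨_, _, _, _, c.shift, ⟨Functor.mapIso _ e ≪≫ (shiftTriangleIso c hf).symm⟩⟩

variable [HasInternalCones A]

theorem rotate_mem {T : Triangle (H0 A)} (hT : T ∈ exactTriangles A) :
    T.rotate ∈ exactTriangles A := by
  obtain ⟨X, Y, f, hf, c, ⟨e⟩⟩ := hT
  obtain ⟨c'⟩ := HasInternalCones.exists_cone c.j c.d_j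
  exact ⟨_, _, _, _, c', ⟨(rotate _).mapIso e ≪≫ (rotateTriangleIso c c' hf).symm⟩⟩

theorem invRotate_mem {T : Triangle (H0 A)} (hT : T ∈ exactTriangles A) :
    T.invRotate ∈ exactTriangles A :=
  mem_exactTriangles_of_iso ((invRotateIsoRotateRotateShiftFunctorNegOne _).app T)
    (shift_neg_one_mem (rotate_mem (rotate_mem hT)))

variable [Nonempty A]

theorem contractible_mem (X : H0 A) : contractibleTriangle X ∈ exactTriangles A := by
  obtain ⟨c⟩ := HasInternalCones.exists_cone (DGCategory.id X.as) (d_id _ _)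
  exact ⟨_, _, _, d_id _ _, c, ⟨triangleIsoMk₃ ((isZero_zero _).iso c.isZero) rfl
    (c.isZero.eq_of_tgt _ _) ((isZero_zero _).eq_of_src _ _)⟩⟩

instance pretriangulated : Pretriangulated (H0 A) where
  distinguishedTriangles := exactTriangles A
  isomorphic_distinguished _ hT _ e := mem_exactTriangles_of_iso e hT
  contractible_distinguished := contractible_mem
  distinguished_cocone_triangle {X Y} F := by
    obtain ⟨f, hf, rfl⟩ := homMk_surjective F
    obtain ⟨c⟩ := HasInternalCones.exists_cone f hf
    exact ⟨_, _, _, coneTriangle_mem f hf c⟩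
  rotate_distinguished_triangle T :=
    ⟨rotate_mem, fun hT => mem_exactTriangles_of_iso ((triangleRotation _).unitIso.app T)
      (invRotate_mem hT)⟩
  complete_distinguished_triangle_morphism _ _ hT hT' a b fac :=
    exists_triangle_morphism hT hT' a b fac

end H0

end Pretriangulated

section Octahedron

variable {A : Type u} [DGCategory.{w} A]

namespace InternalCone

variable {W X Y : A} {q : Hom W Y 0} {f : Hom X Y 0} (b : InternalCone q) (c : InternalCone f)
  (e : InternalCone (DGCategory.comp q c.j (zero_add 0)))

/-- The morphism from an internal cone of `q` to an internal cone of `q ≫ j`, where `j` is the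
inclusion of an internal cone of `f`. -/
def compMap : Hom b.obj e.obj 0 :=
  DGCategory.comp (DGCategory.comp b.t c.j (zero_add 0)) e.j (zero_add 0) +
    DGCategory.comp b.p e.s (add_neg_cancel 1)

theorem j_compMap : DGCategory.comp b.j (compMap b c e) (zero_add 0) =
    DGCategory.comp c.j e.j (zero_add 0) :=
  hom_ext fun x => by simp [compMap]

variable {c}

/-- An internal cone of `q ≫ c.j` is also an internal cone of `f ≫ b.j`: both are the total object
of `W → Y ← X`. -/
def swap : InternalCone (DGCategory.comp f b.j (zero_add 0)) where
  obj := e.obj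
  j := compMap b c e
  t := DGCategory.comp (DGCategory.comp e.t c.t (zero_add 0)) b.j (zero_add 0) +
    DGCategory.comp e.p b.s (add_neg_cancel 1)
  p := DGCategory.comp e.t c.p (zero_add 1)
  s := DGCategory.comp c.s e.j (add_zero (-1))
  j_p := hom_ext fun x => by simp [compMap]
  s_t := hom_ext fun x => by simp
  id_obj := hom_ext fun x => by simp [compMap]; abel
  j_t := hom_ext fun x => by simp [compMap]
  s_p := hom_ext fun x => by simp
  d_j := d_eq_zero_of_diff_map _ fun x => by simp [compMap]; abel
  d_p := d_eq_zero_of_diff_map _ fun x => by simp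
  d_s := d_eq_of_diff_map _ fun x => by simp [compMap, sub_eq_add_neg]

end InternalCone

namespace H0

variable [DGShift A] {W X Y : A} {q : Hom W Y 0} {f : Hom X Y 0} (b : InternalCone q)
  {c : InternalCone f} (e : InternalCone (DGCategory.comp q c.j (zero_add 0)))

theorem j_swap_p_σ : homMk e.j e.d_j ≫ homMk (DGCategory.comp (X := e.obj) (InternalCone.swap b e).p
      (σ 1 X) (add_neg_cancel 1)) (d_p_σ (InternalCone.swap b e)) =
    homMk (DGCategory.comp c.p (σ 1 X) (add_neg_cancel 1)) (d_p_σ c) :=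
  homMk_eq_of_map fun x => by simp [InternalCone.swap]

theorem swap_j_p_σ : homMk (Y := e.obj) (InternalCone.swap b e).j (InternalCone.swap b e).d_j ≫
      homMk (DGCategory.comp e.p (σ 1 W) (add_neg_cancel 1)) (d_p_σ e) =
    homMk (DGCategory.comp b.p (σ 1 W) (add_neg_cancel 1)) (d_p_σ b) :=
  homMk_eq_of_map fun x => by simp [InternalCone.swap, InternalCone.compMap]

theorem swap_p_σ_shiftHom (hq : d (zero_add 1) q = 0) (hf : d (zero_add 1) f = 0) :
    homMk (DGCategory.comp (X := e.obj) (InternalCone.swap b e).p (σ 1 X) (add_neg_cancel 1))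
        (d_p_σ (InternalCone.swap b e)) ≫ homMk (shiftHom 1 f) (d_shiftHom 1 f hf) =
      homMk (DGCategory.comp e.p (σ 1 W) (add_neg_cancel 1)) (d_p_σ e) ≫
        (-homMk (shiftHom 1 q) (d_shiftHom 1 q hq)) :=
  homMk_eq_of_homotopy (-DGCategory.comp (DGCategory.comp e.t c.t (zero_add 0)) (σ 1 Y)
    (zero_add (-1))) fun x => by simp [InternalCone.swap]; abel

variable [HasInternalCones A] [Nonempty A]

/-- The octahedron on the composition of `f : X → Y` with the inclusion `Y → C(q)`. -/
def octahedron (hq : d (zero_add 1) q = 0) (hf : d (zero_add 1) f = 0) :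
    Triangulated.Octahedron (u₁₃ := homMk (DGCategory.comp f b.j (zero_add 0))
        (d_comp_eq_zero _ _ _ _ _ (zero_add 1) hf b.d_j)) rfl
      (coneTriangle_mem f hf c) (rotate_mem (coneTriangle_mem q hq b))
      (coneTriangle_mem _ _ (InternalCone.swap b e)) where
  m₁ := homMk e.j e.d_j
  m₃ := -homMk (DGCategory.comp e.p (σ 1 W) (add_neg_cancel 1)) (d_p_σ e)
  comm₁ := homMk_congr (InternalCone.j_compMap b c e).symm _ _
  comm₂ := (Preadditive.comp_neg _ _).trans (congrArg Neg.neg (j_swap_p_σ b e))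
  comm₃ := (Preadditive.comp_neg _ _).trans (congrArg Neg.neg (swap_j_p_σ b e))
  comm₄ := (Preadditive.neg_comp _ _).trans ((congrArg Neg.neg
    (swap_p_σ_shiftHom b e hq hf)).trans (Preadditive.neg_comp _ _).symm)
  mem := by
    have hqj := d_comp_eq_zero q c.j (zero_add 0) _ _ (zero_add 1) hq c.d_j
    have h : (-(homMk q hq)⟦(1 : ℤ)⟧') ≫ (homMk c.j c.d_j)⟦(1 : ℤ)⟧' =
        -(homMk (DGCategory.comp q c.j (zero_add 0)) hqj)⟦(1 : ℤ)⟧' :=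
      (Preadditive.neg_comp _ _).trans (congrArg Neg.neg (Functor.map_comp _ _ _).symm)
    exact h ▸ rotate_mem (coneTriangle_mem _ hqj e)

instance isTriangulated : IsTriangulated (H0 A) :=
  -- Completing `v` to a triangle `W → Y → Z`, we may assume that `v` is the inclusion of `Y` into
  -- an internal cone.
  IsTriangulated.mk' fun X Y Z u v => by
    obtain ⟨W, q, r, hT⟩ := distinguished_cocone_triangle₁ v
    obtain ⟨u, hu, rfl⟩ := homMk_surjective u
    obtain ⟨q, hq, rfl⟩ := homMk_surjective q
    obtain ⟨b⟩ := HasInternalCones.exists_cone q hq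
    obtain ⟨c⟩ := HasInternalCones.exists_cone u hu
    obtain ⟨e⟩ := HasInternalCones.exists_cone (DGCategory.comp q c.j (zero_add 0))
      (d_comp_eq_zero _ _ _ _ _ (zero_add 1) hq c.d_j)
    let i := isoTriangleOfIso₁₂ _ _ hT (coneTriangle_mem q hq b) (Iso.refl _) (Iso.refl _)
      ((Category.comp_id _).trans (Category.id_comp _).symm)
    exact ⟨X, Y, ⟨b.obj⟩, ⟨c.obj⟩, ⟨DGShift.shift 1 W.as⟩, ⟨e.obj⟩, homMk u hu, homMk b.j b.d_j,
      Iso.refl _, Iso.refl _, Triangle.π₃.mapIso i,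
      (Category.comp_id _).trans (Category.id_comp _).symm, i.hom.comm₂, _, _, _, _, _, _, _, _, _,
      ⟨octahedron b e hq hu⟩⟩

end H0

end Octahedron

section FullSubcategories

variable {A : Type u} [DGCategory.{w} A]

namespace InternalCone

/-- The image of an internal cone in a factor dg category. -/
def factor (I : DGIdeal A) {X Y : A} {f : Hom X Y 0} (c : InternalCone f) :
    InternalCone (X := (⟨X⟩ : Factor I)) (Y := ⟨Y⟩) (QuotientAddGroup.mk f) where
  obj := ⟨c.obj⟩
  j := QuotientAddGroup.mk c.j
  t := QuotientAddGroup.mk c.t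
  p := QuotientAddGroup.mk c.p
  s := QuotientAddGroup.mk c.s
  j_p := congrArg QuotientAddGroup.mk c.j_p
  s_t := congrArg QuotientAddGroup.mk c.s_t
  id_obj := congrArg QuotientAddGroup.mk c.id_obj
  j_t := congrArg QuotientAddGroup.mk c.j_t
  s_p := congrArg QuotientAddGroup.mk c.s_p
  d_j := congrArg QuotientAddGroup.mk c.d_j
  d_p := congrArg QuotientAddGroup.mk c.d_p
  d_s := congrArg QuotientAddGroup.mk c.d_s

/-- An internal cone in a dg category, as an internal cone in a full dg subcategory. -/
def full {P : A → Prop} {X Y : FullDG P} {f : Hom X Y 0}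
    (c : InternalCone (X := X.obj) (Y := Y.obj) f) (h : P c.obj) : InternalCone f where
  __ := c
  obj := ⟨c.obj, h⟩

/-- An internal cone in a full dg subcategory, as an internal cone in the ambient dg category. -/
def ofFull {P : A → Prop} {X Y : FullDG P} {f : Hom X Y 0} (c : InternalCone f) :
    InternalCone (X := X.obj) (Y := Y.obj) f where
  __ := c
  obj := c.obj.obj

end InternalCone

/-- An isomorphism of degree zero in a dg category which is closed, as is its inverse. -/
structure ClosedIso (X Y : A) where
  hom : Hom X Y 0
  inv : Hom Y X 0
  d_hom : d (zero_add 1) hom = 0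
  d_inv : d (zero_add 1) inv = 0
  hom_inv : comp hom inv (zero_add 0) = DGCategory.id X
  inv_hom : comp inv hom (zero_add 0) = DGCategory.id Y

namespace ClosedIso

variable {X Y : A} (α : ClosedIso X Y)

@[simp]
theorem map_inv_map_hom (x : Points X) : map α.inv (map α.hom x) = x := by
  rw [← map_comp _ _ (zero_add 0), α.hom_inv, map_id]

@[simp]
theorem map_hom_map_inv (y : Points Y) : map α.hom (map α.inv y) = y := by
  rw [← map_comp _ _ (zero_add 0), α.inv_hom, map_id]

@[simp]
theorem diff_map_hom (x : Points X) : diff (map α.hom x) = map α.hom (diff x) :=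
  diff_map_of_cocycle α.d_hom x

@[simp]
theorem diff_map_inv (y : Points Y) : diff (map α.inv y) = map α.inv (diff y) :=
  diff_map_of_cocycle α.d_inv y

end ClosedIso

/-- Transport of an internal cone along closed isomorphisms. -/
def InternalCone.ofIso {X Y X' Y' : A} {f : Hom X Y 0} {f' : Hom X' Y' 0} (c : InternalCone f')
    (α : ClosedIso X X') (β : ClosedIso Y Y')
    (h : comp f β.hom (zero_add 0) = comp α.hom f' (zero_add 0)) : InternalCone f :=
  have hf (x : Points X) : map β.hom (map f x) = map f' (map α.hom x) := by
    rw [← map_comp _ _ (zero_add 0), h, map_comp]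
  { obj := c.obj
    j := comp β.hom c.j (zero_add 0)
    t := comp c.t β.inv (zero_add 0)
    p := comp c.p α.inv (add_zero 1)
    s := comp α.hom c.s (zero_add (-1))
    j_p := hom_ext fun x => by simp
    s_t := hom_ext fun x => by simp
    id_obj := hom_ext fun x => by simp
    j_t := hom_ext fun x => by simp
    s_p := hom_ext fun x => by simp
    d_j := d_eq_zero_of_diff_map _ fun x => by simp
    d_p := d_eq_zero_of_diff_map _ fun x => by simp
    d_s := d_eq_of_diff_map _ fun x => by simp [hf, sub_eq_add_neg] }

namespace H0

variable (P : A → Prop)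

instance incl_full : (incl P).Full := ⟨fun f => ⟨f, rfl⟩⟩

instance incl_faithful : (incl P).Faithful := ⟨fun h => h⟩

variable [DGShift A] (hP : ∀ n X, P X → P (shift n X))

/-- The compatibility with the shifts of the inclusion of a full dg subcategory which is closed
under the shifts. -/
@[reducible]
def inclCommShift :
    letI := FullDG.dgShift P hP
    (incl P).CommShift ℤ :=
  letI := FullDG.dgShift P hP
  { commShiftIso n := NatIso.ofComponents (fun X => Iso.refl _)
      fun f => (Category.comp_id _).trans (Category.id_comp _).symm
    commShiftIso_zero := by
      ext X
      refine Eq.trans ?_ (Functor.CommShift.isoZero_hom_app (incl P) ℤ X).symm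
      exact ((shiftFunctorZero (H0 A) ℤ).app ((incl P).obj X)).hom_inv_id.symm
    commShiftIso_add m n := by
      ext X
      let e := (shiftFunctorAdd (H0 A) m n).app ((incl P).obj X)
      refine Eq.trans ?_ (Functor.CommShift.isoAdd_hom_app (F := incl P) _ _ X).symm
      exact e.hom_inv_id.symm.trans (congrArg (e.hom ≫ ·)
        ((Category.id_comp _).symm.trans (congrArg (𝟙 _ ≫ ·)
          ((Category.id_comp _).symm.trans (congrArg (· ≫ e.inv)
            (CategoryTheory.Functor.map_id (shiftFunctor (H0 A) n) _).symm))))) }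

theorem incl_mapTriangle_coneTriangle {X Y : FullDG P} {f : Hom X Y 0}
    (hf : d (zero_add 1) f = 0) (c : InternalCone f) :
    letI := FullDG.dgShift P hP
    letI := inclCommShift P hP
    (incl P).mapTriangle.obj (coneTriangle f hf c) =
      coneTriangle (X := X.obj) (Y := Y.obj) f hf c.ofFull := by
  let := FullDG.dgShift P hP
  let := inclCommShift P hP
  exact congrArg (Triangle.mk (C := H0 A) _ _) (Category.comp_id _)

variable [HasInternalCones A] [Nonempty A] [HasInternalCones (FullDG P)] [Nonempty (FullDG P)]

theorem incl_isTriangulated :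
    letI := FullDG.dgShift P hP
    letI := inclCommShift P hP
    (incl P).IsTriangulated := by
  let := FullDG.dgShift P hP
  let := inclCommShift P hP
  refine ⟨fun T ⟨X, Y, f, hf, c, ⟨e⟩⟩ => ?_⟩
  refine mem_exactTriangles_of_iso ((incl P).mapTriangle.mapIso e) ?_
  rw [incl_mapTriangle_coneTriangle P hP hf c]
  exact coneTriangle_mem _ _ _

theorem isTriangleEmbedding_incl :
    letI := FullDG.dgShift P hP
    IsTriangleEmbedding (incl P) (exactTriangles (FullDG P)) (exactTriangles A) := by
  let := FullDG.dgShift P hP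
  let := inclCommShift P hP
  have := incl_isTriangulated P hP
  exact ⟨inferInstance, inferInstance, inferInstance,
    fun T => ((incl P).map_distinguished_iff T).symm⟩

end H0

end FullSubcategories

section SplitTriangles

variable {C : Type*} [Category* C] [Preadditive C] [HasZeroObject C] [HasShift C ℤ]
  [∀ n : ℤ, (shiftFunctor C n).Additive] [Pretriangulated C]

theorem binaryBicone_triangle_distinguished {X Y : C} (b : BinaryBicone X Y) (hb : b.IsBilimit) :
    Triangle.mk b.inl b.snd (0 : Y ⟶ X⟦(1 : ℤ)⟧) ∈ distTriang C :=
  have h₁ : b.inl ≫ (biprod.uniqueUpToIso X Y hb).hom = biprod.inl := by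
    apply biprod.hom_ext <;> simp
  have h₂ : b.snd = (biprod.uniqueUpToIso X Y hb).hom ≫ biprod.snd := by simp
  isomorphic_distinguished _ (binaryBiproductTriangle_distinguished X Y) _
    (Triangle.isoMk _ _ (Iso.refl _) (biprod.uniqueUpToIso X Y hb) (Iso.refl _)
      (h₁.trans (Category.id_comp _).symm) ((Category.comp_id _).trans h₂)
      (zero_comp.trans comp_zero.symm))

end SplitTriangles

open CochainComplex.HomComplex

section Restriction

variable {𝔞 : Type u} [Category.{v} 𝔞] [Preadditive 𝔞] [HasZeroObject 𝔞] (S : Set ℤ)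
  (X : CochainComplex 𝔞 ℤ)

open scoped Classical in
open ZeroObject in
/-- The components of the brutal restriction of a complex to the degrees in `S`. -/
def restrictX (p : ℤ) : 𝔞 := if p ∈ S then X.X p else 0

variable {S} in
theorem restrictX_of_mem {p : ℤ} (h : p ∈ S) : restrictX S X p = X.X p := if_pos h

/-- The inclusion of the components in the degrees in `S`. -/
def restrictXι (p : ℤ) : restrictX S X p ⟶ X.X p :=
  open scoped Classical in if h : p ∈ S then eqToHom (restrictX_of_mem X h) else 0

/-- The projection to the components in the degrees in `S`. -/
def restrictXπ (p : ℤ) : X.X p ⟶ restrictX S X p :=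
  open scoped Classical in if h : p ∈ S then eqToHom (restrictX_of_mem X h).symm else 0

variable {S}

theorem isZero_restrictX {p : ℤ} (h : p ∉ S) : IsZero (restrictX S X p) := by
  rw [restrictX, if_neg h]
  exact isZero_zero 𝔞

theorem restrictXπ_ι {p : ℤ} (h : p ∈ S) : restrictXπ S X p ≫ restrictXι S X p = 𝟙 _ := by
  simp [restrictXι, restrictXπ, h]

variable (S)

/-- The brutal restriction of a complex to the degrees in `S`. -/
def restrict : CochainComplex 𝔞 ℤ where
  X := restrictX S X
  d p q := restrictXι S X p ≫ X.d p q ≫ restrictXπ S X q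
  shape p q h := by rw [X.shape p q h, Limits.zero_comp, Limits.comp_zero]
  d_comp_d' p q r _ _ := by
    by_cases h : q ∈ S
    · simp [reassoc_of% restrictXπ_ι X h]
    · simp [(isZero_restrictX X h).eq_of_tgt (restrictXπ S X q) 0]

/-- The inclusion of the restriction in each degree. -/
def restrictι (p : ℤ) : (restrict S X).X p ⟶ X.X p := restrictXι S X p

/-- The projection to the restriction in each degree. -/
def restrictπ (p : ℤ) : X.X p ⟶ (restrict S X).X p := restrictXπ S X p

theorem restrict_d (p q : ℤ) :
    (restrict S X).d p q = restrictι S X p ≫ X.d p q ≫ restrictπ S X q := rfl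

@[simp]
theorem restrictι_π (p : ℤ) : restrictι S X p ≫ restrictπ S X p = 𝟙 _ := by
  by_cases h : p ∈ S
  · have e : restrictXι S X p ≫ restrictXπ S X p = 𝟙 _ := by
      simp [restrictXι, restrictXπ, h]
    exact e
  · exact (isZero_restrictX X h).eq_of_src _ _

variable {X} in
theorem isZero_restrict_X_of_isZero {p : ℤ} (h : IsZero (X.X p)) : IsZero ((restrict S X).X p) := by
  rw [IsZero.iff_id_eq_zero, ← restrictι_π, h.eq_of_tgt (restrictι S X p) 0, Limits.zero_comp]

variable {S}

theorem isZero_restrict_X {p : ℤ} (h : p ∉ S) : IsZero ((restrict S X).X p) :=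
  isZero_restrictX X h

theorem restrictπ_ι {p : ℤ} (h : p ∈ S) : restrictπ S X p ≫ restrictι S X p = 𝟙 _ :=
  restrictXπ_ι X h

theorem restrictι_eq_zero {p : ℤ} (h : p ∉ S) : restrictι S X p = 0 :=
  (isZero_restrict_X X h).eq_of_src _ _

theorem restrictπ_eq_zero {p : ℤ} (h : p ∉ S) : restrictπ S X p = 0 :=
  (isZero_restrict_X X h).eq_of_tgt _ _

theorem restrictι_comp_d {p q : ℤ} (h : p ∈ S → q ∈ S) :
    restrictι S X p ≫ X.d p q = (restrict S X).d p q ≫ restrictι S X q := by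
  rw [restrict_d]
  by_cases hp : p ∈ S
  · simp [restrictπ_ι X (h hp)]
  · simp [restrictι_eq_zero X hp]

theorem restrictπ_comp_d {p q : ℤ} (h : q ∈ S → p ∈ S) :
    restrictπ S X p ≫ (restrict S X).d p q = X.d p q ≫ restrictπ S X q := by
  rw [restrict_d]
  by_cases hq : q ∈ S
  · simp [reassoc_of% restrictπ_ι X (h hq)]
  · simp [restrictπ_eq_zero X hq]

variable (S)

/-- The inclusion of the brutal restriction, as a cochain. -/
def restrictInc : Cochain (restrict S X) X 0 := Cochain.ofHoms (restrictι S X)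

/-- The projection to the brutal restriction, as a cochain. -/
def restrictProj : Cochain X (restrict S X) 0 := Cochain.ofHoms (restrictπ S X)

@[simp]
theorem restrictInc_v (p : ℤ) : (restrictInc S X).v p p (add_zero p) = restrictι S X p :=
  Cochain.ofHoms_v _ _

@[simp]
theorem restrictProj_v (p : ℤ) : (restrictProj S X).v p p (add_zero p) = restrictπ S X p :=
  Cochain.ofHoms_v _ _

@[simp]
theorem restrictInc_proj :
    (restrictInc S X).comp (restrictProj S X) (zero_add 0) = Cochain.ofHom (𝟙 _) := by
  ext p
  simp

variable {S}

theorem δ_restrictInc_v {p q : ℤ} (h : p + 1 = q) (hS : p ∈ S → q ∈ S) :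
    (δ 0 1 (restrictInc S X)).v p q h = 0 := by
  rw [δ_zero_cochain_v, restrictInc_v, restrictInc_v, restrictι_comp_d X hS, sub_self]

theorem δ_restrictProj_v {p q : ℤ} (h : p + 1 = q) (hS : q ∈ S → p ∈ S) :
    (δ 0 1 (restrictProj S X)).v p q h = 0 := by
  rw [δ_zero_cochain_v, restrictProj_v, restrictProj_v, restrictπ_comp_d X hS, sub_self]

theorem δ_restrictInc (hS : IsUpperSet S) : δ 0 1 (restrictInc S X) = 0 := by
  ext p q h
  exact δ_restrictInc_v X h (hS (by lia))

theorem δ_restrictProj (hS : IsLowerSet S) : δ 0 1 (restrictProj S X) = 0 := by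
  ext p q h
  exact δ_restrictProj_v X h (hS (by lia))

variable {X} in
theorem IsBoundedAbove.restrict (hX : IsBoundedAbove X) (S : Set ℤ) :
    IsBoundedAbove (restrict S X) :=
  hX.imp fun _ hn p hp => isZero_restrict_X_of_isZero S (hn p hp)

variable {X} in
theorem IsBoundedBelow.restrict (hX : IsBoundedBelow X) (S : Set ℤ) :
    IsBoundedBelow (restrict S X) :=
  hX.imp fun _ hn p hp => isZero_restrict_X_of_isZero S (hn p hp)

theorem isBoundedAbove_restrict_of_bddAbove (hS : BddAbove S) : IsBoundedAbove (restrict S X) :=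
  hS.imp fun _ hn _ hp => isZero_restrict_X X fun h => hp.not_ge (hn h)

theorem isBoundedBelow_restrict_of_bddBelow (hS : BddBelow S) : IsBoundedBelow (restrict S X) :=
  hS.imp fun _ hn _ hp => isZero_restrict_X X fun h => hp.not_ge (hn h)

end Restriction

/-- The closure properties shared by the boundedness conditions on complexes, under which the
complexes satisfying `P` form triangulated subcategories of `K(𝔞)` and of `H⁰(V(𝔞))` containing the
bounded complexes. -/
class IsBoundednessCondition {𝔞 : Type u} [Category.{v} 𝔞] [Preadditive 𝔞] [HasZeroObject 𝔞]
    [HasBinaryBiproducts 𝔞] (P : CochainComplex 𝔞 ℤ → Prop) : Prop where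
  of_isBounded {X : CochainComplex 𝔞 ℤ} : IsBounded X → P X
  shift {X : CochainComplex 𝔞 ℤ} (n : ℤ) : P X → P (X⟦n⟧)
  mappingCone {X Y : CochainComplex 𝔞 ℤ} (f : X ⟶ Y) :
    P X → P Y → P (CochainComplex.mappingCone f)
  restrict {X : CochainComplex 𝔞 ℤ} (S : Set ℤ) : P X → P (restrict S X)

section BoundednessConditions

variable {𝔞 : Type u} [Category.{v} 𝔞] [Preadditive 𝔞] [HasZeroObject 𝔞] [HasBinaryBiproducts 𝔞]

instance : IsBoundednessCondition (IsBoundedAbove (𝔞 := 𝔞)) where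
  of_isBounded hX := hX.1
  shift n hX := hX.shift n
  mappingCone f hX hY := hX.mappingCone f hY
  restrict S hX := hX.restrict S

instance : IsBoundednessCondition (IsBoundedBelow (𝔞 := 𝔞)) where
  of_isBounded hX := hX.2
  shift n hX := hX.shift n
  mappingCone f hX hY := hX.mappingCone f hY
  restrict S hX := hX.restrict S

end BoundednessConditions

section VogelCones

open CochainComplex

variable {𝔞 : Type u} [Category.{v} 𝔞] [Preadditive 𝔞]

/-- The mapping cone of a cochain map is an internal cone. -/
def mappingConeInternal [HasBinaryBiproducts 𝔞] {X Y : CochainComplex 𝔞 ℤ} (f : X ⟶ Y) :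
    InternalCone (X := (⟨X⟩ : Cdg 𝔞)) (Y := ⟨Y⟩) (Cochain.ofHom f) where
  obj := ⟨mappingCone f⟩
  j := Cochain.ofHom (mappingCone.inr f)
  t := mappingCone.snd f
  p := (mappingCone.fst f).1
  s := mappingCone.inl f
  j_p := mappingCone.inr_fst f
  s_t := mappingCone.inl_snd f
  id_obj := mappingCone.id f
  j_t := mappingCone.inr_snd f
  s_p := mappingCone.inl_fst f
  d_j := δ_ofHom _
  d_p := Cocycle.δ_eq_zero _ _
  d_s := (mappingCone.δ_inl f).trans (Cochain.ofHom_comp _ _)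

/-- The class in the Vogel dg category of a homogeneous morphism of complexes. -/
def vogelMk {X Y : CochainComplex 𝔞 ℤ} {n : ℤ} (f : Cochain X Y n) :
    Hom (⟨⟨X⟩⟩ : Vogel 𝔞) ⟨⟨Y⟩⟩ n :=
  QuotientAddGroup.mk (s := (boundedIdeal 𝔞).carrier ⟨X⟩ ⟨Y⟩ n) f

theorem vogelMk_surjective {X Y : Vogel 𝔞} {n : ℤ} (F : Hom X Y n) :
    ∃ f : Cochain X.as.cpx Y.as.cpx n, vogelMk f = F :=
  QuotientAddGroup.mk_surjective F

section

variable {X Y : CochainComplex 𝔞 ℤ} {n : ℤ}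

theorem vogelMk_eq_zero_iff (f : Cochain X Y n) :
    vogelMk f = 0 ↔ ∃ N : ℕ, ∀ (p q : ℤ) (h : p + n = q), N ≤ |p| → f.v p q h = 0 :=
  QuotientAddGroup.eq_zero_iff f

theorem vogelMk_eq_iff (f g : Cochain X Y n) :
    vogelMk f = vogelMk g ↔
      ∃ N : ℕ, ∀ (p q : ℤ) (h : p + n = q), N ≤ |p| → f.v p q h = g.v p q h := by
  have e : vogelMk f - vogelMk g = vogelMk (f - g) := rfl
  rw [← sub_eq_zero, e, vogelMk_eq_zero_iff]
  simp only [Cochain.sub_v, sub_eq_zero]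

theorem vogelMk_eq_zero_of_above_below (hX : IsBoundedAbove X) (hY : IsBoundedBelow Y)
    (f : Cochain X Y n) : vogelMk f = 0 := by
  obtain ⟨a, ha⟩ := hX
  obtain ⟨b, hb⟩ := hY
  refine (vogelMk_eq_zero_iff _).2 ⟨(max (a + 1) (n - b + 1)).toNat, fun p q h hp => ?_⟩
  obtain hp | hp := le_abs.1 hp
  · exact (ha p (by lia)).eq_of_src _ _
  · exact (hb q (by lia)).eq_of_tgt _ _

theorem vogelMk_eq_zero_of_below_above (hX : IsBoundedBelow X) (hY : IsBoundedAbove Y)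
    (f : Cochain X Y n) : vogelMk f = 0 := by
  obtain ⟨a, ha⟩ := hX
  obtain ⟨b, hb⟩ := hY
  refine (vogelMk_eq_zero_iff _).2 ⟨(max (1 - a) (b - n + 1)).toNat, fun p q h hp => ?_⟩
  obtain hp | hp := le_abs.1 hp
  · exact (hb q (by lia)).eq_of_tgt _ _
  · exact (ha p (by lia)).eq_of_src _ _

end

variable [HasZeroObject 𝔞] (X : CochainComplex 𝔞 ℤ)

theorem d_vogelMk_restrictInc {S : Set ℤ} (N : ℕ)
    (hS : ∀ p : ℤ, N ≤ |p| → p ∈ S → p + 1 ∈ S) :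
    d (zero_add 1) (vogelMk (restrictInc S X)) = 0 :=
  (vogelMk_eq_zero_iff _).2 ⟨N, fun p _ h hp => δ_restrictInc_v X h (h ▸ hS p hp)⟩

theorem d_vogelMk_restrictProj {S : Set ℤ} (N : ℕ)
    (hS : ∀ p : ℤ, N ≤ |p| → p + 1 ∈ S → p ∈ S) :
    d (zero_add 1) (vogelMk (restrictProj S X)) = 0 :=
  (vogelMk_eq_zero_iff _).2 ⟨N, fun p _ h hp => δ_restrictProj_v X h (h ▸ hS p hp)⟩

/-- A complex is isomorphic in the Vogel dg category to its brutal restriction to the degrees of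
large absolute value. -/
def restrictIso (N : ℕ) : ClosedIso (⟨⟨X⟩⟩ : Vogel 𝔞) ⟨⟨restrict {p | (N : ℤ) ≤ |p|} X⟩⟩ where
  hom := vogelMk (restrictProj _ X)
  inv := vogelMk (restrictInc _ X)
  d_hom := d_vogelMk_restrictProj X N fun _ hp _ => hp
  d_inv := d_vogelMk_restrictInc X (N + 1) fun p hp _ => by
    rw [Int.abs_eq_natAbs] at hp
    change (N : ℤ) ≤ |p + 1|
    rw [Int.abs_eq_natAbs]
    lia
  hom_inv := (vogelMk_eq_iff _ _).2 ⟨N, fun p q h hp => by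
    obtain rfl : p = q := by lia
    refine (Cochain.comp_zero_cochain_v _ _ _ _ _).trans ?_
    rw [restrictInc_v, restrictProj_v, restrictπ_ι X (S := {p | (N : ℤ) ≤ |p|}) hp]
    exact (Cochain.ofHom_v (𝟙 X) p).symm⟩
  inv_hom := congrArg vogelMk (restrictInc_proj _ X)

variable {X} {Y : CochainComplex 𝔞 ℤ}

/-- The cochain map between the restrictions to the degrees in `S` induced by a cochain of degree
zero which is closed in these degrees. -/
def restrictMap (S : Set ℤ) (f : Cochain X Y 0)
    (hf : ∀ (p q : ℤ) (h : p + 1 = q), p ∈ S → (δ 0 1 f).v p q h = 0) :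
    restrict S X ⟶ restrict S Y where
  f p := restrictι S X p ≫ f.v p p (add_zero p) ≫ restrictπ S Y p
  comm' p q h := by
    simp only [Category.assoc, restrict_d]
    by_cases hp : p ∈ S
    · by_cases hq : q ∈ S
      · have e : f.v p p (add_zero p) ≫ Y.d p q = X.d p q ≫ f.v q q (add_zero q) :=
          sub_eq_zero.1 ((δ_zero_cochain_v f p q h).symm.trans (hf p q h hp))
        rw [reassoc_of% restrictπ_ι Y hp, reassoc_of% restrictπ_ι X hq, reassoc_of% e]
      · simp only [restrictπ_eq_zero Y hq, Limits.comp_zero]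
    · simp only [restrictι_eq_zero X hp, Limits.zero_comp]

variable [HasBinaryBiproducts 𝔞]

theorem exists_internalCone_vogel {X Y : Vogel 𝔞} (f : Hom X Y 0) (hf : d (zero_add 1) f = 0) :
    ∃ (S : Set ℤ) (g : restrict S X.as.cpx ⟶ restrict S Y.as.cpx) (c : InternalCone f),
      c.obj = ⟨⟨mappingCone g⟩⟩ := by
  obtain ⟨f, rfl⟩ := vogelMk_surjective f
  obtain ⟨N, hN⟩ := (vogelMk_eq_zero_iff _).1 hf
  let S : Set ℤ := {p | (N : ℤ) ≤ |p|}
  let g := restrictMap S f hN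
  refine ⟨S, g, ((mappingConeInternal g).factor (boundedIdeal 𝔞)).ofIso (restrictIso _ N)
    (restrictIso _ N) ((vogelMk_eq_iff (f.comp (restrictProj S _) (zero_add 0))
      ((restrictProj S _).comp (Cochain.ofHom g) (zero_add 0))).2 ⟨N, fun p q h hp => ?_⟩), rfl⟩
  obtain rfl : p = q := by lia
  have e := restrictπ_ι X.as.cpx (S := S) hp
  simp [g, restrictMap, reassoc_of% e]

open ZeroObject

variable (𝔞)

instance : HasInternalCones (Vogel 𝔞) where
  exists_cone f hf := have ⟨_, _, c, _⟩ := exists_internalCone_vogel f hf; ⟨c⟩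

instance : Nonempty (Vogel 𝔞) := ⟨⟨⟨0⟩⟩⟩

variable (P : CochainComplex 𝔞 ℤ → Prop) [IsBoundednessCondition P]

instance : HasInternalCones (FullDG fun X : Vogel 𝔞 => P X.as.cpx) where
  exists_cone {X Y} f hf :=
    have ⟨S, g, c, hc⟩ := exists_internalCone_vogel (X := X.obj) (Y := Y.obj) f hf
    have hP : P c.obj.as.cpx := hc ▸ IsBoundednessCondition.mappingCone g
      (IsBoundednessCondition.restrict S X.property) (IsBoundednessCondition.restrict S Y.property)
    ⟨c.full hP⟩

instance : Nonempty (FullDG fun X : Vogel 𝔞 => P X.as.cpx) :=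
  ⟨⟨⟨⟨0⟩⟩, IsBoundednessCondition.of_isBounded (.of_isZero (isZero_zero _))⟩⟩

end VogelCones

section Decomposition

variable {𝔞 : Type u} [Category.{v} 𝔞] [Preadditive 𝔞]

theorem exists_homMk_vogelMk {X Y : H0 (Vogel 𝔞)} (φ : X ⟶ Y) :
    ∃ (f : Cochain X.as.as.cpx Y.as.as.cpx 0) (hf : d (zero_add 1) (vogelMk f) = 0),
      H0.homMk (vogelMk f) hf = φ := by
  obtain ⟨F, hF, rfl⟩ := H0.homMk_surjective φ
  obtain ⟨f, rfl⟩ := vogelMk_surjective F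
  exact ⟨f, hF, rfl⟩

theorem hom_eq_zero_of_above_below {X Y : H0 (Vogel 𝔞)} (hX : IsBoundedAbove X.as.as.cpx)
    (hY : IsBoundedBelow Y.as.as.cpx) (φ : X ⟶ Y) : φ = 0 := by
  obtain ⟨f, hf, rfl⟩ := exists_homMk_vogelMk φ
  exact H0.homMk_congr (vogelMk_eq_zero_of_above_below hX hY f) hf (map_zero _)

theorem hom_eq_zero_of_below_above {X Y : H0 (Vogel 𝔞)} (hX : IsBoundedBelow X.as.as.cpx)
    (hY : IsBoundedAbove Y.as.as.cpx) (φ : X ⟶ Y) : φ = 0 := by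
  obtain ⟨f, hf, rfl⟩ := exists_homMk_vogelMk φ
  exact H0.homMk_congr (vogelMk_eq_zero_of_below_above hX hY f) hf (map_zero _)

variable [HasZeroObject 𝔞]

theorem restrictProj_comp_inc_add_compl (S : Set ℤ) (X : CochainComplex 𝔞 ℤ) :
    (restrictProj S X).comp (restrictInc S X) (zero_add 0) +
      (restrictProj Sᶜ X).comp (restrictInc Sᶜ X) (zero_add 0) = Cochain.ofHom (𝟙 X) := by
  ext p
  simp only [Cochain.add_v, Cochain.comp_zero_cochain_v, restrictProj_v, restrictInc_v,
    Cochain.ofHom_v, HomologicalComplex.id_f]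
  by_cases hp : p ∈ S
  · rw [restrictπ_ι X hp, restrictπ_eq_zero X (not_not.2 hp), Limits.zero_comp, add_zero]
  · rw [restrictπ_ι X (S := Sᶜ) hp, restrictπ_eq_zero X hp, Limits.zero_comp, zero_add]

theorem isBoundedAbove_restrict_compl_Ici (n : ℤ) (X : CochainComplex 𝔞 ℤ) :
    IsBoundedAbove (restrict (Set.Ici n)ᶜ X) :=
  isBoundedAbove_restrict_of_bddAbove X (Set.compl_Ici (a := n) ▸ bddAbove_Iio)

/-- A complex is the biproduct in `H⁰(V(𝔞))` of its restrictions to the nonnegative and to the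
negative degrees. -/
def restrictBicone (Z : CochainComplex 𝔞 ℤ) :
    BinaryBicone (⟨⟨⟨restrict (Set.Ici 0) Z⟩⟩⟩ : H0 (Vogel 𝔞)) ⟨⟨⟨restrict (Set.Ici 0)ᶜ Z⟩⟩⟩ where
  pt := ⟨⟨⟨Z⟩⟩⟩
  inl := H0.homMk (vogelMk (restrictInc _ Z)) (d_vogelMk_restrictInc Z 0 fun p _ hp => by
    simp only [Set.mem_Ici] at hp ⊢; lia)
  fst := H0.homMk (vogelMk (restrictProj _ Z)) (d_vogelMk_restrictProj Z 2 fun p h hp => by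
    simp only [Set.mem_Ici, Int.abs_eq_natAbs] at h hp ⊢; lia)
  inr := H0.homMk (vogelMk (restrictInc _ Z)) (d_vogelMk_restrictInc Z 2 fun p h hp => by
    simp only [Set.mem_compl_iff, Set.mem_Ici, Int.abs_eq_natAbs] at h hp ⊢; lia)
  snd := H0.homMk (vogelMk (restrictProj _ Z)) (d_vogelMk_restrictProj Z 0 fun p _ hp => by
    simp only [Set.mem_compl_iff, Set.mem_Ici] at hp ⊢; lia)
  inl_fst := H0.homMk_congr (congrArg vogelMk (restrictInc_proj _ Z)) _ _
  inr_snd := H0.homMk_congr (congrArg vogelMk (restrictInc_proj _ Z)) _ _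
  inl_snd := hom_eq_zero_of_below_above (isBoundedBelow_restrict_of_bddBelow Z bddBelow_Ici)
    (isBoundedAbove_restrict_compl_Ici 0 Z) _
  inr_fst := hom_eq_zero_of_above_below (isBoundedAbove_restrict_compl_Ici 0 Z)
    (isBoundedBelow_restrict_of_bddBelow Z bddBelow_Ici) _

theorem restrictBicone_total (Z : CochainComplex 𝔞 ℤ) :
    (restrictBicone Z).fst ≫ (restrictBicone Z).inl +
      (restrictBicone Z).snd ≫ (restrictBicone Z).inr = 𝟙 _ :=
  H0.homMk_congr (congrArg vogelMk (restrictProj_comp_inc_add_compl _ Z)) _ _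

variable (𝔞) [HasBinaryBiproducts 𝔞]

theorem isOrthogonalDecomposition_vogel :
    IsOrthogonalDecomposition
      (H0.incl _ : H0 (VogelMinus 𝔞) ⥤ H0 (Vogel 𝔞))
      (H0.incl _ : H0 (VogelPlus 𝔞) ⥤ H0 (Vogel 𝔞))
      (H0.exactTriangles (VogelMinus 𝔞)) (H0.exactTriangles (VogelPlus 𝔞))
      (H0.exactTriangles (Vogel 𝔞)) where
  embedding_left := H0.isTriangleEmbedding_incl _ fun n _ hX => hX.shift n
  embedding_right := H0.isTriangleEmbedding_incl _ fun n _ hX => hX.shift n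
  hom_eq_zero Y X φ := hom_eq_zero_of_below_above Y.as.property X.as.property φ
  hom_eq_zero' X Y φ := hom_eq_zero_of_above_below X.as.property Y.as.property φ
  exists_triangle Z :=
    let b := restrictBicone Z.as.as.cpx
    ⟨⟨⟨_, isBoundedBelow_restrict_of_bddBelow _ bddBelow_Ici⟩⟩,
      ⟨⟨_, isBoundedAbove_restrict_compl_Ici 0 _⟩⟩,
      b.inl, b.snd, 0, binaryBicone_triangle_distinguished b
        (isBinaryBilimitOfTotal b (restrictBicone_total _))⟩

end Decomposition

section FromComplexes

variable {𝔞 : Type u} [Category.{v} 𝔞] [Preadditive 𝔞]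

theorem shiftHom_ofHom (n : ℤ) {X Y : CochainComplex 𝔞 ℤ} (f : X ⟶ Y) :
    H0.shiftHom n (X := (⟨X⟩ : Cdg 𝔞)) (Y := ⟨Y⟩) (Cochain.ofHom f) = Cochain.ofHom (f⟦n⟧') := by
  refine Cochain.ext₀ _ _ fun p => ?_
  have h₁ := Cochain.comp_v (τ n (⟨X⟩ : Cdg 𝔞)) (Cochain.ofHom f) (add_zero n) p (p + n) (p + n)
    rfl (add_zero _)
  have h₂ := Cochain.comp_v ((τ n (⟨X⟩ : Cdg 𝔞)).comp (Cochain.ofHom f) (add_zero n))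
    (σ n (⟨Y⟩ : Cdg 𝔞)) (add_neg_cancel n) p (p + n) p rfl (by lia)
  rw [h₁, Cochain.ofHom_v] at h₂
  rw [Cochain.ofHom_v]
  exact h₂.trans ((Category.comp_id _).trans (Category.id_comp _))

theorem shiftFunctorZero_ofHom (X : CochainComplex 𝔞 ℤ) :
    Cochain.ofHom ((shiftFunctorZero (CochainComplex 𝔞 ℤ) ℤ).hom.app X) =
      τ 0 (⟨X⟩ : Cdg 𝔞) := by
  refine Cochain.ext₀ _ _ fun p => ?_
  rw [Cochain.ofHom_v, CochainComplex.shiftFunctorZero_hom_app_f]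
  rfl

theorem shiftFunctorAdd_ofHom (m n : ℤ) (X : CochainComplex 𝔞 ℤ) :
    Cochain.ofHom ((shiftFunctorAdd (CochainComplex 𝔞 ℤ) m n).hom.app X) =
      H0.shiftAddHom m n (⟨X⟩ : Cdg 𝔞) := by
  refine Cochain.ext₀ _ _ fun p => ?_
  have h₁ := Cochain.comp_v (τ (m + n) (⟨X⟩ : Cdg 𝔞)) (σ m (⟨X⟩ : Cdg 𝔞)) rfl
    p (p + (m + n)) (p + n) rfl (by lia)
  have h₂ := Cochain.comp_v ((τ (m + n) (⟨X⟩ : Cdg 𝔞)).comp (σ m (⟨X⟩ : Cdg 𝔞)) rfl)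
    (σ n (shift m (⟨X⟩ : Cdg 𝔞))) (show m + n + -m + -n = 0 by lia) p (p + n) p (by lia) (by lia)
  rw [h₁] at h₂
  rw [Cochain.ofHom_v, CochainComplex.shiftFunctorAdd_hom_app_f]
  exact ((Category.id_comp _).symm.trans (Category.comp_id _).symm).trans h₂.symm

theorem fromComplexes_map {X Y : CochainComplex 𝔞 ℤ} (f : X ⟶ Y) :
    fromComplexes.map f = H0.homMk (vogelMk (Cochain.ofHom f)) (congrArg vogelMk (δ_ofHom f)) := rfl

theorem H0.shiftFunctorZero_hom_app {A : Type u} [DGCategory.{w} A] [DGShift A] (X : H0 A) :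
    (shiftFunctorZero (H0 A) ℤ).hom.app X =
      H0.homMk (X := shift 0 X.as) (τ 0 X.as) (d_τ 0 X.as _) := rfl

theorem H0.shiftFunctorAdd_hom_app {A : Type u} [DGCategory.{w} A] [DGShift A] (m n : ℤ)
    (X : H0 A) : (shiftFunctorAdd (H0 A) m n).hom.app X =
      H0.homMk (H0.shiftAddHom m n X.as) (H0.d_shiftAddHom m n X.as) := rfl

theorem fromComplexes_map_shiftFunctorZero (X : CochainComplex 𝔞 ℤ) :
    fromComplexes.map ((shiftFunctorZero (CochainComplex 𝔞 ℤ) ℤ).hom.app X) =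
      (shiftFunctorZero (H0 (Vogel 𝔞)) ℤ).hom.app (fromComplexes.obj X) := by
  rw [fromComplexes_map, H0.shiftFunctorZero_hom_app]
  exact H0.homMk_congr (congrArg vogelMk (shiftFunctorZero_ofHom X)) _ _

theorem fromComplexes_map_shiftFunctorAdd (m n : ℤ) (X : CochainComplex 𝔞 ℤ) :
    fromComplexes.map ((shiftFunctorAdd (CochainComplex 𝔞 ℤ) m n).hom.app X) =
      (shiftFunctorAdd (H0 (Vogel 𝔞)) m n).hom.app (fromComplexes.obj X) := by
  rw [fromComplexes_map, H0.shiftFunctorAdd_hom_app]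
  exact H0.homMk_congr (congrArg vogelMk (shiftFunctorAdd_ofHom m n X)) _ _

theorem fromComplexes_map_shift (n : ℤ) {X Y : CochainComplex 𝔞 ℤ} (f : X ⟶ Y) :
    fromComplexes.map (f⟦n⟧') = (fromComplexes.map f)⟦n⟧' := by
  rw [fromComplexes_map, fromComplexes_map]
  have h : vogelMk (Cochain.ofHom (f⟦n⟧')) = H0.shiftHom n (vogelMk (Cochain.ofHom f)) :=
    congrArg vogelMk (shiftHom_ofHom n f).symm
  have hf : d (zero_add 1) (vogelMk (Cochain.ofHom f)) = 0 := congrArg vogelMk (δ_ofHom f)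
  exact (H0.homMk_congr h _ (H0.d_shiftHom n _ hf)).trans (H0.shiftFun_map_homMk n _ hf).symm

/-- The identification of the shifts of complexes with those of `H⁰(V(𝔞))`. -/
def fromComplexesShiftIso (n : ℤ) : shiftFunctor (CochainComplex 𝔞 ℤ) n ⋙ fromComplexes ≅
    fromComplexes ⋙ shiftFunctor (H0 (Vogel 𝔞)) n :=
  NatIso.ofComponents (fun X => Iso.refl (fromComplexes.obj (X⟦n⟧)))
    (fun f => (Category.comp_id _).trans
      ((fromComplexes_map_shift n f).trans (Category.id_comp _).symm))

instance : (fromComplexes (𝔞 := 𝔞)).CommShift ℤ where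
  commShiftIso n := fromComplexesShiftIso n
  commShiftIso_zero := by
    ext X
    rw [Functor.CommShift.isoZero_hom_app, fromComplexes_map_shiftFunctorZero]
    exact ((shiftFunctorZero (H0 (Vogel 𝔞)) ℤ).app (fromComplexes.obj X)).hom_inv_id.symm
  commShiftIso_add m n := by
    ext X
    let e := (shiftFunctorAdd (H0 (Vogel 𝔞)) m n).app (fromComplexes.obj X)
    have h : 𝟙 _ ≫ (shiftFunctor (H0 (Vogel 𝔞)) n).map (𝟙 _) ≫ e.inv = e.inv :=
      (Category.id_comp _).trans
        ((congrArg (· ≫ e.inv)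
          (CategoryTheory.Functor.map_id (shiftFunctor (H0 (Vogel 𝔞)) n) _)).trans
            (Category.id_comp _))
    rw [Functor.CommShift.isoAdd_hom_app, fromComplexes_map_shiftFunctorAdd]
    exact e.hom_inv_id.symm.trans (congrArg (e.hom ≫ ·) h.symm)

theorem fromComplexes_map_eq_of_homotopic {X Y : CochainComplex 𝔞 ℤ} (f g : X ⟶ Y)
    (h : homotopic 𝔞 (ComplexShape.up ℤ) f g) : fromComplexes.map f = fromComplexes.map g :=
  h.elim fun h => Eq.symm <| (H0.cls_eq_iff _ _ _ _).2
    ⟨vogelMk (Cochain.ofHomotopy h), congrArg vogelMk (δ_ofHomotopy h)⟩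

instance : (fromK 𝔞).CommShift ℤ :=
  Quotient.liftCommShift (F := fromComplexes) (A := ℤ)
    (hF := fun _ _ => fromComplexes_map_eq_of_homotopic)

variable (𝔞) in
/-- The factorization of `fromComplexes` through the homotopy category. -/
def quotientCompFromK : HomotopyCategory.quotient 𝔞 (ComplexShape.up ℤ) ⋙ fromK 𝔞 ≅
    fromComplexes :=
  Quotient.lift.isLift _ _ fun _ _ => fromComplexes_map_eq_of_homotopic

instance : NatTrans.CommShift (quotientCompFromK 𝔞).hom ℤ :=
  Quotient.liftCommShift_compatibility (F := fromComplexes) (A := ℤ)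
    (hF := fun _ _ => fromComplexes_map_eq_of_homotopic)

variable [HasBinaryBiproducts 𝔞]

theorem ofHom_triangle_mor₃ {X Y : CochainComplex 𝔞 ℤ} (φ : X ⟶ Y) :
    Cochain.ofHom (CochainComplex.mappingCone.triangle φ).mor₃ =
      -(CochainComplex.mappingCone.fst φ).1.comp (σ 1 (⟨X⟩ : Cdg 𝔞)) (add_neg_cancel 1) := by
  refine Cochain.ext₀ _ _ fun p => ?_
  have h₁ := Cochain.comp_v (CochainComplex.mappingCone.fst φ).1 (σ 1 (⟨X⟩ : Cdg 𝔞))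
    (add_neg_cancel 1) p (p + 1) p rfl (by lia)
  have h₂ := Cochain.rightShift_v (-CochainComplex.mappingCone.fst φ).1 1 0 (zero_add 1)
    p p (add_zero p) (p + 1) rfl
  rw [Cochain.ofHom_v]
  exact h₂.trans ((Preadditive.neg_comp _ _).trans (congrArg Neg.neg h₁.symm))

theorem fromComplexes_mapTriangle {X Y : CochainComplex 𝔞 ℤ} (φ : X ⟶ Y) :
    fromComplexes.mapTriangle.obj (CochainComplex.mappingCone.triangle φ) =
      H0.coneTriangle (X := (⟨⟨X⟩⟩ : Vogel 𝔞)) (Y := ⟨⟨Y⟩⟩) (vogelMk (Cochain.ofHom φ))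
        (congrArg vogelMk (δ_ofHom φ)) ((mappingConeInternal φ).factor (boundedIdeal 𝔞)) :=
  congrArg (Triangle.mk (C := H0 (Vogel 𝔞)) (fromComplexes.map φ)
    (fromComplexes.map (CochainComplex.mappingCone.inr φ)))
    ((Category.comp_id _).trans
      (H0.homMk_congr (congrArg vogelMk (ofHom_triangle_mor₃ φ)) _ _))

variable [HasZeroObject 𝔞]

instance : (fromK 𝔞).IsTriangulated := ⟨by
  rintro T ⟨X, Y, φ, ⟨e⟩⟩
  refine H0.mem_exactTriangles_of_iso ((fromK 𝔞).mapTriangle.mapIso e ≪≫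
    ((Functor.mapTriangleCompIso _ _).app _).symm ≪≫
    (Functor.mapTriangleIso (quotientCompFromK 𝔞)).app _) ?_
  rw [fromComplexes_mapTriangle φ]
  exact H0.coneTriangle_mem _ _ _⟩

end FromComplexes

section Factorization

theorem exists_shift_comp_eq {A : Type u} [DGCategory.{w} A] [DGShift A] {X W Y : A} {n : ℤ}
    (f : Hom X W 0) (g : Hom W Y n) (hf : d (zero_add 1) f = 0) (hg : d rfl g = 0) :
    ∃ (m : ℤ) (f' : Hom X (shift m W) n) (g' : Hom (shift m W) Y 0), d rfl f' = 0 ∧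
      d (zero_add 1) g' = 0 ∧ comp f' g' (add_zero n) = comp f g (zero_add n) := by
  obtain ⟨m, rfl⟩ : ∃ m, n = -m := ⟨-n, (neg_neg n).symm⟩
  refine ⟨m, comp f (σ m W) (zero_add _), comp (τ m W) g (add_neg_cancel m),
    d_comp_eq_zero _ _ _ _ rfl _ hf (d_σ m W _), d_comp_eq_zero _ _ _ rfl _ _ (d_τ m W _) hg, ?_⟩
  rw [assoc f (σ m W) _ _ (add_zero _) _ (zero_add _),
    ← assoc (σ m W) (τ m W) g (neg_add_cancel m) _ (zero_add _) _, σ_τ, DGCategory.id_comp]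

variable {𝔞 : Type u} [Category.{v} 𝔞] [Preadditive 𝔞]

theorem vogelMk_eq_zero_of_isBounded {X W : CochainComplex 𝔞 ℤ} (hW : IsBounded W) {n : ℤ}
    (f : Cochain X W n) : vogelMk f = 0 := by
  obtain ⟨⟨a, ha⟩, b, hb⟩ := hW
  refine (vogelMk_eq_zero_iff _).2
    ⟨(max (a - n + 1) (n - b + 1)).toNat, fun p q h hp => ?_⟩
  obtain hp | hp := le_abs.1 hp
  · exact (ha q (by lia)).eq_of_tgt _ _
  · exact (hb q (by lia)).eq_of_tgt _ _

variable [HasZeroObject 𝔞] {X Y : CochainComplex 𝔞 ℤ}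

/-- The projection of a complex to its brutal restriction to a lower set of degrees. -/
def restrictProjHom {S : Set ℤ} (hS : IsLowerSet S) (X : CochainComplex 𝔞 ℤ) :
    X ⟶ restrict S X :=
  Cocycle.homOf (Cocycle.mk (restrictProj S X) 1 (zero_add 1) (δ_restrictProj X hS))

/-- The inclusion into a complex of its brutal restriction to an upper set of degrees. -/
def restrictIncHom {S : Set ℤ} (hS : IsUpperSet S) (X : CochainComplex 𝔞 ℤ) :
    restrict S X ⟶ X :=
  Cocycle.homOf (Cocycle.mk (restrictInc S X) 1 (zero_add 1) (δ_restrictInc X hS))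

@[simp]
theorem ofHom_restrictProjHom {S : Set ℤ} (hS : IsLowerSet S) :
    Cochain.ofHom (restrictProjHom hS X) = restrictProj S X :=
  Cocycle.cochain_ofHom_homOf_eq_coe _

@[simp]
theorem ofHom_restrictIncHom {S : Set ℤ} (hS : IsUpperSet S) :
    Cochain.ofHom (restrictIncHom hS X) = restrictInc S X :=
  Cocycle.cochain_ofHom_homOf_eq_coe _

theorem comp_restrictProj_comp_inc {n : ℤ} (f : Cochain X Y n) {S : Set ℤ}
    (hf : ∀ p q (h : p + n = q), q ∉ S → f.v p q h = 0) :
    (f.comp (restrictProj S Y) (add_zero n)).comp (restrictInc S Y) (add_zero n) = f := by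
  ext p q h
  rw [Cochain.comp_zero_cochain_v, Cochain.comp_zero_cochain_v, restrictProj_v, restrictInc_v,
    Category.assoc]
  by_cases hq : q ∈ S
  · rw [restrictπ_ι Y hq, Category.comp_id]
  · rw [hf p q h hq, Limits.zero_comp]

theorem restrictProj_comp_inc_comp {n : ℤ} (f : Cochain X Y n) {S : Set ℤ}
    (hf : ∀ p q (h : p + n = q), p ∉ S → f.v p q h = 0) :
    (restrictProj S X).comp ((restrictInc S X).comp f (zero_add n)) (zero_add n) = f := by
  ext p q h
  rw [Cochain.zero_cochain_comp_v, Cochain.zero_cochain_comp_v, restrictProj_v, restrictInc_v]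
  by_cases hp : p ∈ S
  · rw [reassoc_of% restrictπ_ι X hp]
  · rw [hf p q h hp, Limits.comp_zero, Limits.comp_zero]

theorem exists_cocycle_comp_of_isBoundedAbove (hY : IsBoundedAbove Y) {n : ℤ} (f : Cochain X Y n)
    (hf : δ n (n + 1) f = 0) (h₀ : vogelMk f = 0) :
    ∃ (W : CochainComplex 𝔞 ℤ) (_ : IsBounded W) (α : Cocycle X W n) (b : W ⟶ Y),
      α.1.comp (Cochain.ofHom b) (add_zero n) = f := by
  obtain ⟨N, hN⟩ := (vogelMk_eq_zero_iff _).1 h₀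
  let S := Set.Ici (n - N : ℤ)
  let α := f.comp (restrictProj S Y) (add_zero n)
  have hα : α.comp (Cochain.ofHom (restrictIncHom (isUpperSet_Ici _) Y)) (add_zero n) = f := by
    rw [ofHom_restrictIncHom]
    exact comp_restrictProj_comp_inc f fun p q h hq =>
      hN p q h (le_abs.2 (.inr (by simp only [S, Set.mem_Ici] at hq; lia)))
  have hδ : (δ n (n + 1) α).comp (restrictInc S Y) (add_zero _) = 0 := by
    rw [← hα, δ_comp_ofHom, ofHom_restrictIncHom] at hf
    exact hf
  refine ⟨restrict S Y,
    ⟨hY.restrict S, isBoundedBelow_restrict_of_bddBelow Y bddBelow_Ici⟩,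
    Cocycle.mk α (n + 1) rfl ?_, _, hα⟩
  rw [← Cochain.comp_id (δ n (n + 1) α), ← restrictInc_proj,
    ← Cochain.comp_assoc_of_second_is_zero_cochain, hδ, Cochain.zero_comp]

theorem exists_cocycle_comp_of_isBoundedBelow (hX : IsBoundedBelow X) {n : ℤ} (f : Cochain X Y n)
    (hf : δ n (n + 1) f = 0) (h₀ : vogelMk f = 0) :
    ∃ (W : CochainComplex 𝔞 ℤ) (_ : IsBounded W) (α : Cocycle X W n) (b : W ⟶ Y),
      α.1.comp (Cochain.ofHom b) (add_zero n) = f := by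
  obtain ⟨N, hN⟩ := (vogelMk_eq_zero_iff _).1 h₀
  let S := Set.Iic (N : ℤ)
  let β := (restrictInc S X).comp f (zero_add n)
  have hβ : (Cochain.ofHom (restrictProjHom (isLowerSet_Iic _) X)).comp β (zero_add n) = f := by
    rw [ofHom_restrictProjHom]
    exact restrictProj_comp_inc_comp f fun p q h hp =>
      hN p q h (le_abs.2 (.inl (by simp only [Set.mem_Iic] at hp; lia)))
  have hδ : (restrictProj S X).comp (δ n (n + 1) β) (zero_add _) = 0 := by
    rw [← hβ, δ_ofHom_comp, ofHom_restrictProjHom] at hf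
    exact hf
  have hδ' : δ n (n + 1) β = 0 := by
    rw [← Cochain.id_comp (δ n (n + 1) β), ← restrictInc_proj,
      Cochain.comp_assoc_of_first_is_zero_cochain, hδ, Cochain.comp_zero]
  obtain ⟨m, α, b, dα, db, h⟩ := exists_shift_comp_eq (X := (⟨X⟩ : Cdg 𝔞)) (W := ⟨restrict S X⟩)
    (Y := ⟨Y⟩) (Cochain.ofHom (restrictProjHom (isLowerSet_Iic _) X)) β (δ_ofHom _) hδ'
  refine ⟨(restrict S X)⟦m⟧,
    .shift ⟨isBoundedAbove_restrict_of_bddAbove X bddAbove_Iic, hX.restrict S⟩ m,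
    Cocycle.mk α (n + 1) rfl dα, Cocycle.homOf (Cocycle.mk b 1 (zero_add 1) db), ?_⟩
  rw [Cocycle.cochain_ofHom_homOf_eq_coe]
  exact h.trans hβ

theorem exists_cocycle_comp (h : IsBoundedAbove Y ∨ IsBoundedBelow X) {n m : ℤ}
    (hm : n + 1 = m) (f : Cochain X Y n) (hf : δ n m f = 0) (h₀ : vogelMk f = 0) :
    ∃ (W : CochainComplex 𝔞 ℤ) (_ : IsBounded W) (α : Cocycle X W n) (b : W ⟶ Y),
      α.1.comp (Cochain.ofHom b) (add_zero n) = f := by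
  subst hm
  exact h.elim (exists_cocycle_comp_of_isBoundedAbove · f hf h₀)
    (exists_cocycle_comp_of_isBoundedBelow · f hf h₀)

theorem exists_factor_of_fromComplexes_map_eq_zero (h : IsBoundedAbove Y ∨ IsBoundedBelow X)
    (f : X ⟶ Y) (hf : fromComplexes.map f = 0) :
    ∃ (W : CochainComplex 𝔞 ℤ) (_ : IsBounded W) (a : X ⟶ W) (b : W ⟶ Y),
      Nonempty (Homotopy f (a ≫ b)) := by
  obtain ⟨k, hk⟩ := (H0.cls_eq_iff _ _ (map_zero _) _).1 hf.symm
  obtain ⟨k, rfl⟩ := vogelMk_surjective (X := ⟨⟨X⟩⟩) (Y := ⟨⟨Y⟩⟩) k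
  have hk' : vogelMk (Cochain.ofHom f - δ (-1) 0 k) = 0 :=
    sub_eq_zero.2 ((sub_zero _).symm.trans hk.symm)
  obtain ⟨W, hW, α, b, e⟩ := exists_cocycle_comp h (zero_add 1) (Cochain.ofHom f - δ (-1) 0 k)
    (by rw [δ_sub, δ_ofHom, δ_δ, sub_zero]) hk'
  refine ⟨W, hW, Cocycle.homOf α, b, ⟨(Cochain.equivHomotopy _ _).symm ⟨k, ?_⟩⟩⟩
  rw [Cochain.ofHom_comp, Cocycle.cochain_ofHom_homOf_eq_coe, e, add_sub_cancel]

theorem exists_fromComplexes_map_eq_comp_inr [HasBinaryBiproducts 𝔞]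
    (h : IsBoundedAbove Y ∨ IsBoundedBelow X)
    (φ : fromComplexes.obj X ⟶ fromComplexes.obj Y) :
    ∃ (W : CochainComplex 𝔞 ℤ) (_ : IsBounded W) (b : W ⟶ Y)
      (f : X ⟶ CochainComplex.mappingCone b), fromComplexes.map f =
        φ ≫ fromComplexes.map (CochainComplex.mappingCone.inr b) := by
  obtain ⟨g, hg, rfl⟩ := exists_homMk_vogelMk φ
  obtain ⟨W, hW, α, b, e⟩ := exists_cocycle_comp h (by lia) (δ 0 1 g) (δ_δ 0 1 2 g) hg
  refine ⟨W, hW, b, CochainComplex.mappingCone.lift b (-α) g ?_, ?_⟩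
  · rw [← e, Cocycle.coe_neg, Cochain.neg_comp, add_neg_cancel]
  · have hl : vogelMk (CochainComplex.mappingCone.liftCochain b (-α).1 g (zero_add 1)) =
        vogelMk (g.comp (Cochain.ofHom (CochainComplex.mappingCone.inr b)) (zero_add 0)) :=
      calc
        _ = comp (vogelMk (-α).1) (vogelMk (CochainComplex.mappingCone.inl b))
              (add_neg_cancel 1) + vogelMk _ := rfl
        _ = _ := by
          rw [vogelMk_eq_zero_of_isBounded hW, DGCategory.zero_comp, zero_add]
          rfl
    exact H0.homMk_congr
      ((congrArg vogelMk (CochainComplex.mappingCone.ofHom_lift b (-α) g _)).trans hl) _ _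

end Factorization

section VerdierQuotient

theorem full_of_exists_comp_eq {C C' E : Type*} [Category* C] [Category* C'] [Category* E]
    (W : MorphismProperty C) (L : C ⥤ C') [L.IsLocalization W] (hL : Function.Surjective L.obj)
    (G : C' ⥤ E)
    (h : ∀ {X Y : C} (φ : G.obj (L.obj X) ⟶ G.obj (L.obj Y)), ∃ (Y' : C) (s : Y ⟶ Y')
      (f : X ⟶ Y'), W s ∧ G.map (L.map f) = φ ≫ G.map (L.map s)) : G.Full where
  map_surjective {X Y} φ := by
    obtain ⟨X, rfl⟩ := hL X
    obtain ⟨Y, rfl⟩ := hL Y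
    obtain ⟨Y', s, f, hs, e⟩ := h φ
    have := Localization.inverts L W s hs
    exact ⟨L.map f ≫ inv (L.map s), by rw [G.map_comp, G.map_inv, IsIso.comp_inv_eq, e]⟩

variable {T : Type u} [Category.{v} T] [HasZeroObject T] [HasShift T ℤ]
  [Preadditive T] [∀ n : ℤ, (shiftFunctor T n).Additive] [Pretriangulated T]
  {D : Type*} [Category* D] [HasZeroObject D] [HasShift D ℤ]
  [Preadditive D] [∀ n : ℤ, (shiftFunctor D n).Additive] [Pretriangulated D]
  (P : ObjectProperty T) (F : T ⥤ D) [F.CommShift ℤ] [F.IsTriangulated]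

theorem trW_isInvertedBy (h : ∀ X, P X → IsZero (F.obj X)) : P.trW.IsInvertedBy F := by
  rintro X Y s ⟨Z, g, k, hT, hZ⟩
  exact (Triangle.isZero₃_iff_isIso₁ _ (F.map_distinguished _ hT)).1 (h _ hZ)

variable {P F} [IsTriangulated T] [P.IsTriangulated] {G : VerdierQuotient P ⥤ D}

open ZeroObject in
theorem isZero_verdierQuotient {X : T} (hX : P X) : IsZero (P.trW.Q.obj X) := by
  have h : P.trW (0 : X ⟶ 0) := ObjectProperty.trW.mk P
    (rot_of_distTriang _ (contractible_distinguished X)) (P.le_shift 1 X hX)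
  have := Localization.inverts P.trW.Q P.trW _ h
  exact (P.trW.Q.map_isZero (isZero_zero T)).of_iso (asIso (P.trW.Q.map (0 : X ⟶ 0)))

theorem faithful_of_exists_factor [G.Additive] (hG : P.trW.Q ⋙ G = F)
    (h : ∀ {X Y : T} (f : X ⟶ Y), F.map f = 0 → ∃ (W : T) (a : X ⟶ W) (b : W ⟶ Y),
      P W ∧ f = a ≫ b) : G.Faithful := by
  subst hG
  refine Functor.faithful_of_comp_cancel_zero_of_hasLeftCalculusOfFractions P.trW.Q P.trW G
    fun X Y f hf => ?_
  obtain ⟨W, a, b, hW, rfl⟩ := h f hf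
  rw [Functor.map_comp, (isZero_verdierQuotient hW).eq_of_tgt (P.trW.Q.map a) 0,
    Limits.zero_comp]

theorem isTriangleIsomorphism_of_verdierQuotient (hG : P.trW.Q ⋙ G = F)
    (hbij : Function.Bijective F.obj)
    (h₁ : ∀ {X Y : T} (φ : F.obj X ⟶ F.obj Y), ∃ (Y' : T) (s : Y ⟶ Y') (f : X ⟶ Y'),
      P.trW s ∧ F.map f = φ ≫ F.map s)
    (h₂ : ∀ {X Y : T} (f : X ⟶ Y), F.map f = 0 → ∃ (W : T) (a : X ⟶ W) (b : W ⟶ Y),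
      P W ∧ f = a ≫ b) :
    IsTriangleIsomorphism G (distTriang (VerdierQuotient P)) (distTriang D) := by
  let : Localization.Lifting P.trW.Q P.trW F G := ⟨eqToIso hG⟩
  let : G.CommShift ℤ := Functor.commShiftOfLocalization P.trW.Q P.trW ℤ F G
  have := NatTrans.commShift_iso_hom_of_localization P.trW.Q P.trW ℤ F G
  have := Localization.essSurj_mapArrow P.trW.Q P.trW
  have : G.IsTriangulated :=
    Functor.isTriangulated_of_precomp_iso (Localization.Lifting.iso P.trW.Q P.trW F G)
  have := faithful_of_exists_factor hG h₂
  subst hG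
  let hQ := Localization.Construction.objEquiv P.trW
  have := full_of_exists_comp_eq P.trW P.trW.Q hQ.surjective G h₁
  exact ⟨⟨inferInstance, inferInstance, inferInstance, fun X => (G.map_distinguished_iff X).symm⟩,
    hbij.comp hQ.symm.bijective⟩

end VerdierQuotient

section VerdierVogel

variable {𝔞 : Type u} [Category.{v} 𝔞] [Preadditive 𝔞] (P : CochainComplex 𝔞 ℤ → Prop)

/-- The objects of `K(𝔞)` given by the complexes satisfying `P`. -/
def objectsOf : ObjectProperty (K 𝔞) := fun X => P X.as

/-- The canonical functor to `H⁰(V(𝔞))` restricted to the complexes satisfying `P`; for the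
bounded-above and the bounded-below complexes it is `fromKMinus` and `fromKPlus`. -/
def fromKOf : (objectsOf P).FullSubcategory ⥤ H0 (FullDG fun X : Vogel 𝔞 => P X.as.cpx) where
  obj X := ⟨⟨⟨⟨X.obj.as⟩⟩, X.property⟩⟩
  map f := (fromK 𝔞).map f.hom
  map_id X := (fromK 𝔞).map_id X.obj
  map_comp f g := (fromK 𝔞).map_comp f.hom g.hom

theorem fromKOf_obj_bijective : Function.Bijective (fromKOf P).obj :=
  Function.bijective_iff_has_inverse.2
    ⟨fun X => ⟨⟨X.as.obj.as.cpx⟩, X.as.property⟩, fun _ => rfl, fun _ => rfl⟩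

/-- The bounded complexes, as a triangulated subcategory of the complexes satisfying `P`. -/
def boundedIn : ObjectProperty (objectsOf P).FullSubcategory :=
  (bounded 𝔞).inverseImage (objectsOf P).ι

variable {P} in
theorem isZero_fromKOf_obj {X : (objectsOf P).FullSubcategory} (hX : boundedIn P X) :
    IsZero ((fromKOf P).obj X) :=
  (IsZero.iff_id_eq_zero _).2
    (hom_eq_zero_of_above_below (Y := (fromK 𝔞).obj X.obj) hX.1 hX.2 (𝟙 ((fromK 𝔞).obj X.obj)))

variable [HasZeroObject 𝔞] [HasBinaryBiproducts 𝔞] [IsBoundednessCondition P]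

instance : (objectsOf P).IsTriangulated :=
  isTriangulated_of_cone 𝔞 P
    (fun _ hX => IsBoundednessCondition.of_isBounded (.of_isZero hX))
    (fun _ n hX => IsBoundednessCondition.shift n hX)
    (fun _ _ f hX hY => IsBoundednessCondition.mappingCone f hX hY)

theorem bounded_le_objectsOf : bounded 𝔞 ≤ objectsOf P :=
  fun _ hX => IsBoundednessCondition.of_isBounded hX

instance : (boundedIn P).IsTriangulated :=
  isTriangulated_inverseImage_ι _ _ (bounded_le_objectsOf P)

local instance : DGShift (FullDG fun X : Vogel 𝔞 => P X.as.cpx) :=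
  FullDG.dgShift _ fun n _ hX => IsBoundednessCondition.shift (P := P) n hX

local instance : (H0.incl fun X : Vogel 𝔞 => P X.as.cpx).CommShift ℤ :=
  H0.inclCommShift _ fun n _ hX => IsBoundednessCondition.shift (P := P) n hX

local instance : (H0.incl fun X : Vogel 𝔞 => P X.as.cpx).IsTriangulated :=
  H0.incl_isTriangulated _ fun n _ hX => IsBoundednessCondition.shift (P := P) n hX

/-- The functor `fromKOf P` is a restriction of `fromK`. -/
def fromKOfCompIncl : fromKOf P ⋙ H0.incl _ ≅ (objectsOf P).ι ⋙ fromK 𝔞 :=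
  Iso.refl ((objectsOf P).ι ⋙ fromK 𝔞)

instance : (fromKOf P).CommShift ℤ := Functor.CommShift.ofComp (fromKOfCompIncl P) ℤ

instance : NatTrans.CommShift (fromKOfCompIncl P).hom ℤ :=
  Functor.CommShift.ofComp_compatibility (fromKOfCompIncl P) ℤ

instance : (fromKOf P).IsTriangulated :=
  (Functor.isTriangulated_iff_comp_right (fromKOfCompIncl P)).2 inferInstance

variable {P}

theorem trW_boundedIn_mappingCone_inr {W Y : CochainComplex 𝔞 ℤ} (hW : IsBounded W) (hY : P Y)
    (b : W ⟶ Y) (hb : P (CochainComplex.mappingCone b)) :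
    (boundedIn P).trW (X := ⟨(HomotopyCategory.quotient _ _).obj Y, hY⟩)
      (Y := ⟨(HomotopyCategory.quotient _ _).obj (CochainComplex.mappingCone b), hb⟩)
      (ObjectProperty.homMk
        ((HomotopyCategory.quotient _ _).map (CochainComplex.mappingCone.inr b))) := by
  refine ((objectsOf P).trW_inverseImage_ι_iff (bounded 𝔞) _).2 ?_
  rw [inf_eq_right.2 (bounded_le_objectsOf P)]
  exact ObjectProperty.trW.mk' _ (HomotopyCategory.mappingCone_triangleh_distinguished b) hW

theorem exists_trW_fromKOf_map_eq
    (hP : (∀ X, P X → IsBoundedAbove X) ∨ ∀ X, P X → IsBoundedBelow X)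
    {X Y : (objectsOf P).FullSubcategory}
    (φ : (fromKOf P).obj X ⟶ (fromKOf P).obj Y) :
    ∃ (Y' : (objectsOf P).FullSubcategory) (s : Y ⟶ Y') (f : X ⟶ Y'),
      (boundedIn P).trW s ∧ (fromKOf P).map f = φ ≫ (fromKOf P).map s := by
  obtain ⟨W, hW, b, f, e⟩ := exists_fromComplexes_map_eq_comp_inr
    (hP.imp (· _ Y.property) (· _ X.property)) φ
  have hb : P (CochainComplex.mappingCone b) := IsBoundednessCondition.mappingCone b
    (IsBoundednessCondition.of_isBounded hW) Y.property
  exact ⟨⟨(HomotopyCategory.quotient _ _).obj _, hb⟩, _,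
    ObjectProperty.homMk ((HomotopyCategory.quotient _ _).map f),
    trW_boundedIn_mappingCone_inr hW Y.property b hb, e⟩

theorem exists_factor_of_fromKOf_map_eq_zero
    (hP : (∀ X, P X → IsBoundedAbove X) ∨ ∀ X, P X → IsBoundedBelow X)
    {X Y : (objectsOf P).FullSubcategory} (f : X ⟶ Y) (hf : (fromKOf P).map f = 0) :
    ∃ (W : (objectsOf P).FullSubcategory) (a : X ⟶ W) (b : W ⟶ Y),
      boundedIn P W ∧ f = a ≫ b := by
  obtain ⟨f, rfl⟩ := ObjectProperty.homMk_surjective f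
  obtain ⟨f, rfl⟩ := (HomotopyCategory.quotient _ _).map_surjective f
  obtain ⟨W, hW, a, b, ⟨h⟩⟩ := exists_factor_of_fromComplexes_map_eq_zero
    (hP.imp (· _ Y.property) (· _ X.property)) f hf
  exact ⟨⟨(HomotopyCategory.quotient _ _).obj W, IsBoundednessCondition.of_isBounded hW⟩,
    ObjectProperty.homMk ((HomotopyCategory.quotient _ _).map a),
    ObjectProperty.homMk ((HomotopyCategory.quotient _ _).map b), hW,
    ObjectProperty.hom_ext _ (HomotopyCategory.eq_of_homotopy _ _ h)⟩

theorem exists_verdierQuotient_iso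
    (hP : (∀ X, P X → IsBoundedAbove X) ∨ ∀ X, P X → IsBoundedBelow X) :
    ∃ Φ : VerdierQuotient (boundedIn P) ⥤ H0 (FullDG fun X : Vogel 𝔞 => P X.as.cpx),
      (boundedIn P).trW.Q ⋙ Φ = fromKOf P ∧
        IsTriangleIsomorphism Φ (distTriang (VerdierQuotient (boundedIn P)))
          (H0.exactTriangles (FullDG fun X : Vogel 𝔞 => P X.as.cpx)) := by
  have h := Localization.Construction.fac (fromKOf P)
    (trW_isInvertedBy (boundedIn P) _ fun _ => isZero_fromKOf_obj)
  exact ⟨_, h, isTriangleIsomorphism_of_verdierQuotient h (fromKOf_obj_bijective P)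
    (exists_trW_fromKOf_map_eq hP) (exists_factor_of_fromKOf_map_eq_zero hP)⟩

end VerdierVogel

end VogelDG

end

theorem theorem3p9 (𝔞 : Type u) [Category.{v} 𝔞] [Preadditive 𝔞] [HasZeroObject 𝔞]
    [HasBinaryBiproducts 𝔞] :
    -- the homotopy categories of the Vogel dg categories are triangulated
    IsTriangulatedCategory (H0 (Vogel 𝔞)) (H0.exactTriangles (Vogel 𝔞)) ∧
    IsTriangulatedCategory (H0 (VogelMinus 𝔞)) (H0.exactTriangles (VogelMinus 𝔞)) ∧
    IsTriangulatedCategory (H0 (VogelPlus 𝔞)) (H0.exactTriangles (VogelPlus 𝔞)) ∧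
    -- the orthogonal decomposition
    IsOrthogonalDecomposition
      (H0.incl _ : H0 (VogelMinus 𝔞) ⥤ H0 (Vogel 𝔞))
      (H0.incl _ : H0 (VogelPlus 𝔞) ⥤ H0 (Vogel 𝔞))
      (H0.exactTriangles (VogelMinus 𝔞)) (H0.exactTriangles (VogelPlus 𝔞))
      (H0.exactTriangles (Vogel 𝔞)) ∧
    -- the isomorphisms of triangulated categories
    (∃ Φ : VerdierQuotient (boundedInMinus 𝔞) ⥤ H0 (VogelMinus 𝔞),
      (boundedInMinus 𝔞).trW.Q ⋙ Φ = fromKMinus 𝔞 ∧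
      IsTriangleIsomorphism Φ (distTriang (VerdierQuotient (boundedInMinus 𝔞)))
        (H0.exactTriangles (VogelMinus 𝔞))) ∧
    (∃ Φ : VerdierQuotient (boundedInPlus 𝔞) ⥤ H0 (VogelPlus 𝔞),
      (boundedInPlus 𝔞).trW.Q ⋙ Φ = fromKPlus 𝔞 ∧
      IsTriangleIsomorphism Φ (distTriang (VerdierQuotient (boundedInPlus 𝔞)))
        (H0.exactTriangles (VogelPlus 𝔞))) := by
  exact ⟨⟨inferInstance, inferInstance, inferInstance, rfl, inferInstance⟩,
    ⟨inferInstance, inferInstance, inferInstance, rfl, inferInstance⟩,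
    ⟨inferInstance, inferInstance, inferInstance, rfl, inferInstance⟩,
    isOrthogonalDecomposition_vogel 𝔞,
    exists_verdierQuotient_iso (P := IsBoundedAbove) (.inl fun _ => id),
    exists_verdierQuotient_iso (P := IsBoundedBelow) (.inr fun _ => id)⟩
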